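/- **Setting.** Let $\mathcal S\subseteq\mathbb R^n$ and $\mathcal A\subseteq\mathbb R^m$ be Borel convex sets with non-empty interior, and let $(\mathcal S,\mathcal A,P,R,\mu,\gamma)$ be a discounted Markov decision process: $P$ a Markov kernel from $\mathcal S\times\mathcal A$ to $\mathcal S$, $R:\mathcal S\times\mathcal A\to[0,R_{\max}]$ measurable, $\mu$ a probability measure on $\mathcal S$, $\gamma\in[0,1)$. A policy is a Markov kernel $\pi(\cdot|s)$ from $\mathcal S$ to $\mathcal A$; fix a set $\Pi$ of admissible policies. Put $\mathbb P(\nu,\pi)=\mathbb E_{s\sim\nu,\,a\sim\pi(\cdot|s)}P(s,a)$, $\mathbb P^0(\nu,\pi)=\nu$, $\mathbb P^{t+1}(\nu,\pi)=\mathbb P(\mathbb P^t(\nu,\pi),\pi)$, $\rho^\pi_\mu=(1-\gamma)\sum_{t\ge0}\gamma^t\,\mathbb P^t(\mu,\pi)$, $V^\pi(s)=\mathbb E[\sum_{t\ge 0}\gamma^tR(s_t,a_t)\mid s_0=s;\pi]$, $Q^\pi(s,a)=R(s,a)+\gamma\,\mathbb E_{s'\sim P(s,a)}V^\pi(s')$,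 $A^\pi(s,\pi')=\mathbb E_{a\sim\pi'(\cdot|s)}[Q^\pi(s,a)-V^\pi(s)]$ and $\eta_\pi=\mathbb E_{s\sim\mu}V^\pi(s)$. Let $W(\zeta,\nu)=\inf_c\int\|x-y\|_2\,dc(x,y)\in[0,\infty]$ over couplings $c$ of $\zeta,\nu$, let $W(\pi_1,\pi_2)=\sup_sW(\pi_1(\cdot|s),\pi_2(\cdot|s))$, and let $\mathrm{Lip}(f;a)=\sup_a\|\nabla_af\|_2$. **Assumptions.** (i) For all $\pi,\pi'\in\Pi$ the functions $Q^\pi(s,a)$ (in $s$ and in $a$), $\nabla_sQ^\pi(s,a)$ (in $a$) and $A^\pi(s,\pi')$ (in $s$) are differentiable, and $\ell_\pi:=\sup_s\mathrm{Lip}(Q^\pi(s,a);a)$ and $\ell'_\pi:=\sup_s\|\mathrm{Lip}(\nabla_sQ^\pi(s,a);a)\|_2$ are finite, where in $\ell'_\pi$ the constant $\mathrm{Lip}$ is taken in each component of $\nabla_sQ^\pi$. (ii) There are $L_\pi,L_\mu\in[0,\infty)$ such that $W(\mathbb P(\nu,\pi_1),\mathbb P(\nu,\pi_2))\le L_\pi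 W(\pi_1,\pi_2)$ and $W(\mathbb P(\nu_1,\pi),\mathbb P(\nu_2,\pi))\le L_\mu W(\nu_1,\nu_2)$ for all probability measures $\nu,\nu_1,\nu_2$ on $\mathcal S$ and all $\pi,\pi_1,\pi_2\in\Pi$. (iii) Either $\gamma L_\mu<1$, and then $\kappa:=L_\pi/(1-\gamma L_\mu)$; or $W(\pi_1,\pi_2)<\infty$ for all $\pi_1,\pi_2\in\Pi$ and $$C_L:=\sup_{\nu,\ \pi_1,\pi_2\in\Pi,\ t}\ \sum_{k=1}^t\hat L^{(t-k)}_{\nu,\pi_1,\pi_2}\prod_{i=1}^{k-1}\tilde L^{(t-i)}_{\nu,\pi_1,\pi_2}<\infty,$$ and then $\kappa:=C_L$. Here $\hat L^{(t)}_{\nu,\pi_1,\pi_2}$ is the infimum of the $L\ge0$ with $W(\mathbb P(\nu_t,\pi_1),\mathbb P(\nu_t,\pi_2))=L\,W(\pi_1,\pi_2)$, and $\tilde L^{(t)}_{\nu,\pi_1,\pi_2}$ is the infimum of the $L\ge0$ with $W(\mathbb P(\nu_t,\pi_2),\mathbb P(\nu_t',\pi_2))=L\,W(\nu_t,\nu_t')$,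 where $\nu_t=\mathbb P^t(\nu,\pi_1)$ and $\nu_t'=\mathbb P^t(\nu,\pi_2)$. **Surrogate.** For $s\in\mathcal S$ and $1\le j\le n$ let $$\partial_j(\pi_1,\pi_2;s)=\limsup_{h\to0}\frac1{|h|}\,W\Big(\tfrac{\pi_2(\cdot|s+he_j)+\pi_1(\cdot|s)}2,\tfrac{\pi_2(\cdot|s)+\pi_1(\cdot|s+he_j)}2\Big)$$ (over $h\ne0$ with $s+he_j\in\mathcal S$), and $\mathcal L_{G^2}(\pi_1,\pi_2;s)=\sum_{j=1}^n\partial_j(\pi_1,\pi_2;s)^2$. This is the squared norm of the gradient at $s'=s$ of the non-negative function $s'\mapsto W\big(\tfrac{\pi_2(\cdot|s')+\pi_1(\cdot|s)}2,\tfrac{\pi_2(\cdot|s)+\pi_1(\cdot|s')}2\big)$, which vanishes at $s'=s$, formed with difference quotients by $|h|$. For $\alpha\neq0$ put $C_1'=\frac{2\gamma\kappa\,\ell_{\pi_1}}{1-\gamma}$, $C_2'=\frac{\gamma\kappa\,\ell'_{\pi_1}}{1-\gamma}$, $C_1=\frac{\alpha^2}2C_1'$, $C_2=C_2'+\frac{C_1'}{2\alpha^2}$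 and $$\mathcal L^{\sup}_{\pi_1}(\pi_2)=\eta_{\pi_1}+\frac1{1-\gamma}\mathbb E_{s\sim\rho^{\pi_1}_\mu}[A^{\pi_1}(s,\pi_2)]-C_1\sup_s\mathcal L_{G^2}(\pi_1,\pi_2;s)-C_2\sup_sW(\pi_2(\cdot|s),\pi_1(\cdot|s))^2\in[-\infty,\infty),$$ with $0\cdot\infty=0$. **Theorem.** For every $\alpha\ne0$ and all $\pi_1,\pi_2\in\Pi$: $\eta_{\pi_2}\ge\mathcal L^{\sup}_{\pi_1}(\pi_2)$ and $\mathcal L^{\sup}_{\pi_1}(\pi_1)=\eta_{\pi_1}$. Consequently, if $\pi_0,\pi_1,\pi_2,\dots\in\Pi$ are such that $\pi_{k+1}$ maximizes $\mathcal L^{\sup}_{\pi_k}$ over $\Pi$ for every $k$ (where the non-zero parameter $\alpha=\alpha_k$ may depend on $k$), then $\eta_{\pi_0}\le\eta_{\pi_1}\le\eta_{\pi_2}\le\cdots$. -/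

import Mathlib

open MeasureTheory ProbabilityTheory Filter Topology
open scoped ENNReal NNReal

noncomputable section

namespace TDPO

/-! ### Euclidean domains, gradients and Lipschitz constants -/

/-- The Euclidean space `ℝ^d` with its `2`-norm. -/
abbrev E (d : ℕ) := EuclideanSpace ℝ (Fin d)

/-- Gradient at `x` of a function defined on `X ⊆ ℝ^d` (the derivative is taken within `X`, so
the values of the extension outside `X` are irrelevant). -/
def gradOn {d : ℕ} {X : Set (E d)} (f : X → ℝ) (x : X) : E d :=
  gradientWithin (Function.extend Subtype.val f 0) X (x : E d)

/-- Differentiability on `X` of a function defined on `X ⊆ ℝ^d`. -/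
def DiffOn {d : ℕ} {X : Set (E d)} (f : X → ℝ) : Prop :=
  DifferentiableOn ℝ (Function.extend Subtype.val f 0) X

/-- `Lip(f; x) = sup_x ‖∇ f(x)‖₂`, as an element of `[0, ∞]`. -/
def lipConst {d : ℕ} {X : Set (E d)} (f : X → ℝ) : ℝ≥0∞ := ⨆ x : X, ‖gradOn f x‖ₑ

/-! ### The Wasserstein distance -/

/-- `c` is a coupling of `ζ` and `ν`. -/
def IsCoupling {X : Type*} [MeasurableSpace X] (ζ ν : Measure X) (c : Measure (X × X)) : Prop :=
  c.map Prod.fst = ζ ∧ c.map Prod.snd = ν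

/-- The Wasserstein distance `W(ζ, ν) = inf_c ∫ ‖x - y‖ dc(x, y)`, with values in `[0, ∞]`. -/
def wass {X : Type*} [MeasurableSpace X] [PseudoEMetricSpace X] (ζ ν : Measure X) : ℝ≥0∞ :=
  ⨅ (c : Measure (X × X)) (_ : IsCoupling ζ ν c), ∫⁻ p, edist p.1 p.2 ∂c

/-! ### Markov decision processes and policies -/

/-- An infinite-horizon discounted MDP with state space `S ⊆ ℝ^n` and action space `A ⊆ ℝ^m`. -/
structure MDP {n m : ℕ} (S : Set (E n)) (A : Set (E m)) where
  /-- transition dynamics -/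
  P : Kernel (S × A) S
  markov : IsMarkovKernel P
  /-- reward -/
  R : S × A → ℝ
  measurable_R : Measurable R
  Rmax : ℝ
  R_mem : ∀ x, R x ∈ Set.Icc 0 Rmax
  /-- initial state distribution -/
  μ : Measure S
  prob : IsProbabilityMeasure μ
  /-- discount factor -/
  γ : ℝ
  γ_nonneg : 0 ≤ γ
  γ_lt_one : γ < 1

/-- A policy `s ↦ π(· | s)`: a Markov kernel from states to actions. -/
structure Policy {n m : ℕ} (S : Set (E n)) (A : Set (E m)) where
  toKernel : Kernel S A
  markov : IsMarkovKernel toKernel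

attribute [instance] MDP.markov MDP.prob Policy.markov

/-- `W(π₁, π₂) = sup_s W(π₁(·|s), π₂(·|s))`. -/
def policyW {n m : ℕ} {S : Set (E n)} {A : Set (E m)} (π₁ π₂ : Policy S A) : ℝ≥0∞ :=
  ⨆ s : S, wass (π₁.toKernel s) (π₂.toKernel s)

/-- The mixture `(ζ + ν) / 2`. -/
def mix {X : Type*} [MeasurableSpace X] (ζ ν : Measure X) : Measure X := (2⁻¹ : ℝ≥0∞) • (ζ + ν)

/-- `W((π₂(·|s') + π₁(·|s)) / 2, (π₂(·|s) + π₁(·|s')) / 2)`. It is nonnegative and vanishes at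
`s' = s`. -/
def mixW {n m : ℕ} {S : Set (E n)} {A : Set (E m)} (π₁ π₂ : Policy S A) (s s' : S) : ℝ≥0∞ :=
  wass (mix (π₂.toKernel s') (π₁.toKernel s)) (mix (π₂.toKernel s) (π₁.toKernel s'))

/-- The `j`-th partial derivative of `s' ↦ mixW π₁ π₂ s s'` at `s' = s`. The function is
nonnegative and vanishes at `s`, so it has a (typically non-smooth) minimum there, and the
derivative is the limit of `mixW π₁ π₂ s (s + h e_j) / |h|` as `h → 0`, `h ≠ 0`, `s + h e_j ∈ S`
(for differentiable deterministic policies: half the norm of the difference of the `j`-th columns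
of the two Jacobians). It is written with `limsup` so as to be defined in all cases. -/
def partialMixW {n m : ℕ} {S : Set (E n)} {A : Set (E m)} (π₁ π₂ : Policy S A) (s : S)
    (j : Fin n) : ℝ≥0∞ :=
  limsup (fun s' : S => mixW π₁ π₂ s s' / edist s' s)
    (𝓝[{s' : S | s' ≠ s ∧ ∃ h : ℝ, (s' : E n) = (s : E n) + h • EuclideanSpace.single j 1}] s)

/-- The sensitivity term `L_{G²}(π₁, π₂; s) = ‖∇_{s'} mixW(s, s')|_{s'=s}‖₂²`. -/
def LG2 {n m : ℕ} {S : Set (E n)} {A : Set (E m)} (π₁ π₂ : Policy S A) (s : S) : ℝ≥0∞ :=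
  ∑ j : Fin n, partialMixW π₁ π₂ s j ^ 2

namespace MDP

variable {n m : ℕ} {S : Set (E n)} {A : Set (E m)} (M : MDP S A)

/-- `ℙ(ν, π) = E_{s∼ν, a∼π(s)} P(s, a)`. -/
def step (ν : Measure S) (π : Policy S A) : Measure S :=
  ν.bind (M.P ∘ₖ (Kernel.id ×ₖ π.toKernel))

/-- The `t`-step dynamics `ℙ^t(ν, π)`. -/
def steps (ν : Measure S) (π : Policy S A) : ℕ → Measure S
  | 0 => ν
  | t + 1 => M.step (steps ν π t) π

/-- The discounted visitation frequency `ρ_ν^π = (1 - γ) ∑_t γ^t ℙ^t(ν, π)`. -/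
def visit (ν : Measure S) (π : Policy S A) : Measure S :=
  Measure.sum fun t : ℕ => ENNReal.ofReal ((1 - M.γ) * M.γ ^ t) • M.steps ν π t

/-- The value function: expected discounted sum of the rewards started from `s`, where the state
at time `t` has law `ℙ^t(δ_s, π)`. -/
def V (π : Policy S A) (s : S) : ℝ :=
  ∑' t : ℕ, M.γ ^ t * ∫ s', ∫ a, M.R (s', a) ∂(π.toKernel s') ∂(M.steps (Measure.dirac s) π t)

/-- `Q^π(s, a) = R(s, a) + γ E_{s'∼P(s,a)} V^π(s')`. -/
def Q (π : Policy S A) (s : S) (a : A) : ℝ := M.R (s, a) + M.γ * ∫ s', M.V π s' ∂(M.P (s, a))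

/-- The advantage `A^π(s, π') = E_{a∼π'(s)} [Q^π(s, a) - V^π(s)]`. -/
def adv (π : Policy S A) (s : S) (π' : Policy S A) : ℝ :=
  ∫ a, (M.Q π s a - M.V π s) ∂(π'.toKernel s)

/-- The payoff `η_π = E_{s∼μ} V^π(s)`. -/
def payoff (π : Policy S A) : ℝ := ∫ s, M.V π s ∂M.μ

/-- `sup_s Lip(Q^π(s, a); a)`. -/
def lipQ (π : Policy S A) : ℝ≥0∞ := ⨆ s : S, lipConst fun a : A => M.Q π s a

/-- `sup_s ‖Lip(∇_s Q^π(s, a); a)‖₂`, where `Lip` is taken in each of the `n` components. -/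
def lipGradQ (π : Policy S A) : ℝ≥0∞ :=
  ⨆ s : S, (∑ j : Fin n,
    lipConst (fun a : A => gradOn (fun s' : S => M.Q π s' a) s j) ^ 2) ^ (1 / 2 : ℝ)

/-- Regularity of the action values and advantages on the admissible class `Pol`: all the gradients
that are used exist, and the Lipschitz constants of `Q` and `∇_s Q` in the action are finite. -/
structure Regular (Pol : Set (Policy S A)) : Prop where
  diff_action : ∀ π ∈ Pol, ∀ s, DiffOn fun a : A => M.Q π s a
  diff_state : ∀ π ∈ Pol, ∀ a, DiffOn fun s : S => M.Q π s a
  diff_mixed : ∀ π ∈ Pol, ∀ s, ∀ j : Fin n,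
    DiffOn fun a : A => gradOn (fun s' : S => M.Q π s' a) s j
  diff_adv : ∀ π ∈ Pol, ∀ π' ∈ Pol, DiffOn fun s : S => M.adv π s π'
  lipQ_ne_top : ∀ π ∈ Pol, M.lipQ π ≠ ∞
  lipGradQ_ne_top : ∀ π ∈ Pol, M.lipGradQ π ≠ ∞

/-- The dynamics is Lipschitz with respect to the policy, with constant `Lπ`. -/
def LipschitzPolicy (Pol : Set (Policy S A)) (Lπ : ℝ≥0) : Prop :=
  ∀ ν : Measure S, IsProbabilityMeasure ν → ∀ π₁ ∈ Pol, ∀ π₂ ∈ Pol,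
    wass (M.step ν π₁) (M.step ν π₂) ≤ Lπ * policyW π₁ π₂

/-- The dynamics is Lipschitz with respect to the state distribution, with constant `Lμ`. -/
def LipschitzState (Pol : Set (Policy S A)) (Lμ : ℝ≥0) : Prop :=
  ∀ ν₁ ν₂ : Measure S, IsProbabilityMeasure ν₁ → IsProbabilityMeasure ν₂ → ∀ π ∈ Pol,
    wass (M.step ν₁ π) (M.step ν₂ π) ≤ Lμ * wass ν₁ ν₂

/-! ### Dynamics stability -/

/-- The least `L ≥ 0` with `W(ℙ(ν₁, π), ℙ(ν₂, π)) = L W(ν₁, ν₂)`. -/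
def ratioState (ν₁ ν₂ : Measure S) (π : Policy S A) : ℝ≥0∞ :=
  sInf {L | wass (M.step ν₁ π) (M.step ν₂ π) = L * wass ν₁ ν₂}

/-- The least `L ≥ 0` with `W(ℙ(ν, π₁), ℙ(ν, π₂)) = L W(π₁, π₂)`. -/
def ratioPolicy (ν : Measure S) (π₁ π₂ : Policy S A) : ℝ≥0∞ :=
  sInf {L | wass (M.step ν π₁) (M.step ν π₂) = L * policyW π₁ π₂}

/-- `L̃^{(t)}`. -/
def tildeL (ν : Measure S) (π₁ π₂ : Policy S A) (t : ℕ) : ℝ≥0∞ :=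
  M.ratioState (M.steps ν π₁ t) (M.steps ν π₂ t) π₂

/-- `L̂^{(t)}`. -/
def hatL (ν : Measure S) (π₁ π₂ : Policy S A) (t : ℕ) : ℝ≥0∞ :=
  M.ratioPolicy (M.steps ν π₁ t) π₁ π₂

/-- `C_L^{(t)} = ∑_{k=1}^t L̂^{(t-k)} ∏_{i=1}^{k-1} L̃^{(t-i)}`. -/
def CLt (ν : Measure S) (π₁ π₂ : Policy S A) (t : ℕ) : ℝ≥0∞ :=
  ∑ k ∈ Finset.Icc 1 t, M.hatL ν π₁ π₂ (t - k) *
    ∏ i ∈ Finset.Icc 1 (k - 1), M.tildeL ν π₁ π₂ (t - i)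

/-- `C_L`, the supremum of `C_L^{(t)}` over initial distributions, pairs of admissible policies
and times. -/
def CL (Pol : Set (Policy S A)) : ℝ≥0∞ :=
  ⨆ (ν : Measure S) (_ : IsProbabilityMeasure ν) (π₁ ∈ Pol) (π₂ ∈ Pol) (t : ℕ), M.CLt ν π₁ π₂ t

/-- `κ` is an admissible amplification constant of the dynamics: either `γ Lμ < 1` and
`κ = Lπ / (1 - γ Lμ)`, or the dynamics is stable (`C_L < ∞`, the distances of admissible policies
being finite) and `κ = C_L`, which is `Lπ / (1 - γ L̄μ)` for the `L̄μ` defined by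
`C_L = Lπ ∑_t (γ L̄μ)^t`. -/
def IsAmplification (Pol : Set (Policy S A)) (Lπ Lμ : ℝ≥0) (κ : ℝ≥0∞) : Prop :=
  (M.γ * Lμ < 1 ∧ κ = ENNReal.ofReal (Lπ / (1 - M.γ * Lμ))) ∨
  ((∀ π₁ ∈ Pol, ∀ π₂ ∈ Pol, policyW π₁ π₂ ≠ ∞) ∧ M.CL Pol ≠ ∞ ∧ κ = M.CL Pol)

/-! ### The surrogate -/

/-- `C₁' = sup_s 2 Lip(Q^{π₁}(s, a); a) γ κ / (1 - γ)`. -/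
def C1' (κ : ℝ≥0∞) (π₁ : Policy S A) : ℝ≥0∞ :=
  2 * M.lipQ π₁ * ENNReal.ofReal (M.γ / (1 - M.γ)) * κ

/-- `C₂' = sup_s ‖Lip(∇_s Q^{π₁}(s, a); a)‖₂ γ κ / (1 - γ)`. -/
def C2' (κ : ℝ≥0∞) (π₁ : Policy S A) : ℝ≥0∞ :=
  M.lipGradQ π₁ * ENNReal.ofReal (M.γ / (1 - M.γ)) * κ

/-- `C₁ = C₁' α² / 2`. -/
def C1 (κ : ℝ≥0∞) (α : ℝ) (π₁ : Policy S A) : ℝ≥0∞ :=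
  M.C1' κ π₁ * ENNReal.ofReal (α ^ 2 / 2)

/-- `C₂ = C₂' + C₁' / (2 α²)`. -/
def C2 (κ : ℝ≥0∞) (α : ℝ) (π₁ : Policy S A) : ℝ≥0∞ :=
  M.C2' κ π₁ + M.C1' κ π₁ * ENNReal.ofReal (1 / (2 * α ^ 2))

/-- The surrogate
`L^sup_{π₁}(π₂) = η_{π₁} + (1-γ)⁻¹ E_{s∼ρ_μ^{π₁}} A^{π₁}(s, π₂)
  - C₁ sup_s L_{G²}(π₁, π₂; s) - C₂ sup_s W(π₂(·|s), π₁(·|s))²`;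
it is `-∞` where the penalty is infinite. -/
def surrogate (κ : ℝ≥0∞) (α : ℝ) (π₁ π₂ : Policy S A) : EReal :=
  ((M.payoff π₁ + (1 - M.γ)⁻¹ * ∫ s, M.adv π₁ s π₂ ∂(M.visit M.μ π₁) : ℝ) : EReal) -
    ((M.C1 κ α π₁ * (⨆ s : S, LG2 π₁ π₂ s) +
      M.C2 κ α π₁ * (⨆ s : S, wass (π₂.toKernel s) (π₁.toKernel s) ^ 2) : ℝ≥0∞) : EReal)

end MDP

end TDPO

end

/-!
Freezing the action distributions at `s` splits the variation of `z ↦ A^{π₁}(z, π₂)` near `s` in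
two. The part due to `∇_s Q` has slope at most `ℓ' W(π₂(·|s), π₁(·|s))`, by differentiating under a
coupling of the two action laws. The part due to the change of the action laws is
`2 (∫ Q(z, ·) d(π₂(z) + π₁(s)) / 2 - ∫ Q(z, ·) d(π₂(s) + π₁(z)) / 2)`, whose partial slopes are
at most `2 ℓ ∂_j(π₁, π₂; s)`. So the advantage is Lipschitz in the state with constant
`K = 2 ℓ (sup L_{G²})^{1/2} + ℓ' W(π₁, π₂)`. By the performance difference formula, replacing the
visitation of `π₂` by that of `π₁` costs at most `K ∑ γ^t W(ℙ^t(μ, π₁), ℙ^t(μ, π₂))`, hence at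
most `K γ κ W(π₁, π₂) / (1 - γ)`, and Young's inequality turns this product into the two penalties
of the surrogate. The penalties vanish at `π₂ = π₁`, so the surrogate is a minorant of the payoff
that is tight at `π₁`, and maximizing it cannot decrease the payoff.
-/

namespace TDPO

section Wasserstein

variable {X : Type*} [MeasurableSpace X]

theorem isCoupling_prod (ζ ν : Measure X) [IsProbabilityMeasure ζ] [IsProbabilityMeasure ν] :
    IsCoupling ζ ν (ζ.prod ν) :=
  ⟨measurePreserving_fst.map_eq, measurePreserving_snd.map_eq⟩

theorem isCoupling_map_diag (ζ : Measure X) : IsCoupling ζ ζ (ζ.map fun x => (x, x)) := by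
  have hdiag : Measurable fun x : X => (x, x) := by fun_prop
  exact ⟨(Measure.map_map measurable_fst hdiag).trans Measure.map_id,
    (Measure.map_map measurable_snd hdiag).trans Measure.map_id⟩

namespace IsCoupling

variable {ζ ν : Measure X} {c : Measure (X × X)}

theorem swap (hc : IsCoupling ζ ν c) : IsCoupling ν ζ (c.map Prod.swap) :=
  ⟨(Measure.map_map measurable_fst measurable_swap).trans hc.2,
    (Measure.map_map measurable_snd measurable_swap).trans hc.1⟩

theorem isFiniteMeasure (hc : IsCoupling ζ ν c) [IsFiniteMeasure ν] : IsFiniteMeasure c := by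
  have : IsFiniteMeasure (c.map Prod.snd) := by rwa [hc.2]
  exact Measure.isFiniteMeasure_of_map measurable_snd.aemeasurable

theorem integral_sub {F : Type*} [NormedAddCommGroup F] [NormedSpace ℝ F]
    (hc : IsCoupling ζ ν c) {f : X → F} (hζ : Integrable f ζ) (hν : Integrable f ν) :
    ∫ x, f x ∂ζ - ∫ x, f x ∂ν = ∫ p, (f p.1 - f p.2) ∂c := by
  rw [← hc.1] at hζ ⊢
  rw [← hc.2] at hν ⊢
  rw [integral_map measurable_fst.aemeasurable hζ.aestronglyMeasurable,
    integral_map measurable_snd.aemeasurable hν.aestronglyMeasurable]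
  exact (MeasureTheory.integral_sub (hζ.comp_measurable measurable_fst)
    (hν.comp_measurable measurable_snd)).symm

/-- The gluing lemma: `τ` draws the first pair from `c` and then continues with the conditional
law of the second coordinate under `c'`. -/
theorem exists_glue [StandardBorelSpace X] {ξ : Measure X} [IsFiniteMeasure ν]
    {c' : Measure (X × X)} (hc : IsCoupling ζ ν c) (hc' : IsCoupling ν ξ c') :
    ∃ τ : Measure ((X × X) × X), τ.map Prod.fst = c ∧ τ.map (fun q => (q.1.2, q.2)) = c' := by
  rcases isEmpty_or_nonempty X with _ | _
  · exact ⟨0, Subsingleton.elim _ _, Subsingleton.elim _ _⟩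
  have := hc.isFiniteMeasure
  have : IsFiniteMeasure (c'.map Prod.fst) := by rwa [hc'.1]
  have : IsFiniteMeasure c' := Measure.isFiniteMeasure_of_map measurable_fst.aemeasurable
  have hm : Measurable fun q : (X × X) × X => (q.1.2, q.2) := by fun_prop
  refine ⟨c ⊗ₘ (c'.condKernel.comap Prod.snd measurable_snd), Measure.fst_compProd _ _, ?_⟩
  have hdis : (c.map Prod.snd) ⊗ₘ c'.condKernel = c' := by
    rw [hc.2, ← hc'.1]
    exact c'.disintegrate c'.condKernel
  refine Measure.ext_of_lintegral _ fun f hf => ?_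
  rw [lintegral_map hf hm, Measure.lintegral_compProd (by fun_prop)]
  conv_rhs => rw [← hdis, Measure.lintegral_compProd hf,
    lintegral_map hf.lintegral_kernel_prod_right' measurable_snd]
  rfl

end IsCoupling

variable [PseudoEMetricSpace X]

theorem wass_le_of_isCoupling {ζ ν : Measure X} {c : Measure (X × X)} (hc : IsCoupling ζ ν c) :
    wass ζ ν ≤ ∫⁻ p, edist p.1 p.2 ∂c :=
  iInf₂_le c hc

theorem wass_comm (ζ ν : Measure X) : wass ζ ν = wass ν ζ := by
  suffices h : ∀ ζ ν : Measure X, wass ζ ν ≤ wass ν ζ from le_antisymm (h _ _) (h _ _)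
  intro ζ ν
  refine le_iInf₂ fun c hc => ?_
  calc wass ζ ν ≤ ∫⁻ p, edist p.1 p.2 ∂(c.map Prod.swap) := wass_le_of_isCoupling hc.swap
    _ ≤ ∫⁻ p, edist p.2 p.1 ∂c := lintegral_map_le _ _
    _ = ∫⁻ p, edist p.1 p.2 ∂c := by simp only [edist_comm]

@[simp]
theorem wass_self (ζ : Measure X) : wass ζ ζ = 0 := by
  refine nonpos_iff_eq_zero.1 ((wass_le_of_isCoupling (isCoupling_map_diag ζ)).trans ?_)
  exact (lintegral_map_le _ _).trans_eq (by simp)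

theorem wass_triangle [OpensMeasurableSpace X] [SecondCountableTopology X] [StandardBorelSpace X]
    (ζ ν ξ : Measure X) [IsFiniteMeasure ν] : wass ζ ξ ≤ wass ζ ν + wass ν ξ := by
  suffices h : ∀ c, IsCoupling ζ ν c → ∀ c', IsCoupling ν ξ c' →
      wass ζ ξ ≤ ∫⁻ p, edist p.1 p.2 ∂c + ∫⁻ p, edist p.1 p.2 ∂c' by
    simp only [wass, ENNReal.iInf_add, ENNReal.add_iInf, le_iInf_iff] at h ⊢
    exact fun c hc c' hc' => h c' hc' c hc
  intro c hc c' hc'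
  obtain ⟨τ, hτ, hτ'⟩ := hc.exists_glue hc'
  have hm : Measurable fun q : (X × X) × X => (q.1.2, q.2) := by fun_prop
  have hm' : Measurable fun q : (X × X) × X => (q.1.1, q.2) := by fun_prop
  have hτ'' : IsCoupling ζ ξ (τ.map fun q => (q.1.1, q.2)) := by
    rw [← hc.1, ← hc'.2, ← hτ, ← hτ', Measure.map_map measurable_fst measurable_fst,
      Measure.map_map measurable_snd hm]
    exact ⟨Measure.map_map measurable_fst hm', Measure.map_map measurable_snd hm'⟩
  calc wass ζ ξ ≤ ∫⁻ p, edist p.1 p.2 ∂(τ.map fun q => (q.1.1, q.2)) := wass_le_of_isCoupling hτ''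
    _ ≤ ∫⁻ q, edist q.1.1 q.2 ∂τ := lintegral_map_le _ _
    _ ≤ ∫⁻ q, edist q.1.1 q.1.2 + edist q.1.2 q.2 ∂τ :=
        lintegral_mono fun q => edist_triangle _ _ _
    _ = ∫⁻ p, edist p.1 p.2 ∂c + ∫⁻ p, edist p.1 p.2 ∂c' := by
        rw [lintegral_add_left (by fun_prop), ← hτ, ← hτ',
          lintegral_map (by fun_prop) measurable_fst, lintegral_map (by fun_prop) hm]

/-- `K = ∞` is excluded because `0 * ∞ = 0` while a vanishing infimum need not be attained. -/
theorem mul_wass {ζ ν : Measure X} [IsProbabilityMeasure ζ] [IsProbabilityMeasure ν]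
    {K : ℝ≥0∞} (hK : K ≠ ∞) :
    K * wass ζ ν = ⨅ (c : Measure (X × X)) (_ : IsCoupling ζ ν c),
      K * ∫⁻ p, edist p.1 p.2 ∂c := by
  have : Nonempty {c // IsCoupling ζ ν c} := ⟨_, isCoupling_prod ζ ν⟩
  rw [wass, iInf_subtype', iInf_subtype', ENNReal.mul_iInf fun h => absurd h hK]

variable {F : Type*} [NormedAddCommGroup F] [NormedSpace ℝ F]

theorem enorm_integral_sub_le_of_ne_top {ζ ν : Measure X} [IsProbabilityMeasure ζ]
    [IsProbabilityMeasure ν] {f : X → F} (hζ : Integrable f ζ) (hν : Integrable f ν) {K : ℝ≥0∞}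
    (hK : K ≠ ∞) (hf : ∀ x y, ‖f x - f y‖ₑ ≤ K * edist x y) :
    ‖∫ x, f x ∂ζ - ∫ x, f x ∂ν‖ₑ ≤ K * wass ζ ν := by
  rw [mul_wass hK]
  refine le_iInf₂ fun c hc => ?_
  rw [hc.integral_sub hζ hν, ← lintegral_const_mul' _ _ hK]
  exact (enorm_integral_le_lintegral_enorm _).trans (lintegral_mono fun p => hf _ _)

theorem eq_of_wass_eq_zero [BorelSpace X] {ζ ν : Measure X} [IsProbabilityMeasure ζ]
    [IsProbabilityMeasure ν] (h : wass ζ ν = 0) : ζ = ν := by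
  let ζ' : ProbabilityMeasure X := ⟨ζ, ‹_›⟩
  let ν' : ProbabilityMeasure X := ⟨ν, ‹_›⟩
  suffices h' : Tendsto (fun _ : Unit => ζ') ⊤ (𝓝 ν') from
    congrArg ProbabilityMeasure.toMeasure (tendsto_nhds_unique tendsto_const_nhds h')
  refine tendsto_iff_forall_lipschitz_integral_tendsto.2 fun f ⟨C, hC⟩ ⟨L, hL⟩ => ?_
  have hint (ξ : Measure X) [IsProbabilityMeasure ξ] : Integrable f ξ :=
    (BoundedContinuousFunction.mkOfBound ⟨f, hL.continuous⟩ C hC).integrable ξ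
  have := enorm_integral_sub_le_of_ne_top (hint ζ) (hint ν) ENNReal.coe_ne_top
    fun x y => (edist_eq_enorm_sub (f x) (f y)).symm.trans_le (hL x y)
  rw [h, mul_zero, nonpos_iff_eq_zero, enorm_eq_zero, sub_eq_zero] at this
  change Tendsto (fun _ => ∫ x, f x ∂ζ) _ (𝓝 (∫ x, f x ∂ν))
  rw [this]
  exact tendsto_const_nhds

/-- The elementary half of Kantorovich duality. -/
theorem enorm_integral_sub_le_wass [BorelSpace X] {ζ ν : Measure X} [IsProbabilityMeasure ζ]
    [IsProbabilityMeasure ν] {f : X → F} (hζ : Integrable f ζ) (hν : Integrable f ν) {K : ℝ≥0∞}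
    (hf : ∀ x y, ‖f x - f y‖ₑ ≤ K * edist x y) :
    ‖∫ x, f x ∂ζ - ∫ x, f x ∂ν‖ₑ ≤ K * wass ζ ν := by
  rcases eq_or_ne K ∞ with rfl | hK
  · rcases eq_or_ne (wass ζ ν) 0 with h | h
    · simp [eq_of_wass_eq_zero h]
    · simp [ENNReal.top_mul h]
  · exact enorm_integral_sub_le_of_ne_top hζ hν hK hf

end Wasserstein

section Gradient

variable {d : ℕ} {X : Set (E d)} {f g : X → ℝ} {x : X}

theorem extend_coe (f : X → ℝ) (x : X) : Function.extend Subtype.val f 0 (x : E d) = f x :=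
  Subtype.val_injective.extend_apply f 0 x

theorem DiffOn.hasFDerivWithinAt (hf : DiffOn f) (x : X) :
    HasFDerivWithinAt (Function.extend Subtype.val f 0)
      (InnerProductSpace.toDual ℝ (E d) (gradOn f x)) X x :=
  (hf x x.2).hasGradientWithinAt.hasFDerivWithinAt

theorem DiffOn.hasFDerivAt (hf : DiffOn f) (hx : (x : E d) ∈ interior X) :
    HasFDerivAt (Function.extend Subtype.val f 0)
      (InnerProductSpace.toDual ℝ (E d) (gradOn f x)) x :=
  (hf.hasFDerivWithinAt x).hasFDerivAt (mem_interior_iff_mem_nhds.1 hx)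

theorem DiffOn.continuous (hf : DiffOn f) : Continuous f := by
  have hcont := continuousOn_iff_continuous_domRestrict.1 (DifferentiableOn.continuousOn hf)
  exact hcont.congr (extend_coe f)

theorem enorm_sub_le_top_mul_edist (f : X → ℝ) (x y : X) : ‖f x - f y‖ₑ ≤ ∞ * edist x y := by
  rcases eq_or_ne x y with rfl | hxy
  · simp
  · simp [ENNReal.top_mul (edist_pos.2 hxy).ne']

theorem DiffOn.enorm_sub_le_of_convex (hf : DiffOn f) {D : Set (E d)} (hD : Convex ℝ D)
    (hDX : D ⊆ X) {C : ℝ≥0∞} (hC : ∀ x : X, (x : E d) ∈ D → ‖gradOn f x‖ₑ ≤ C) {x y : X}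
    (hx : (x : E d) ∈ D) (hy : (y : E d) ∈ D) : ‖f x - f y‖ₑ ≤ C * edist x y := by
  induction C with
  | top => exact enorm_sub_le_top_mul_edist f x y
  | coe C =>
    have hlip : LipschitzOnWith C (Function.extend Subtype.val f 0) D := by
      refine hD.lipschitzOnWith_of_nnnorm_hasFDerivWithin_le
        (f' := fun z => InnerProductSpace.toDual ℝ (E d)
          (gradientWithin (Function.extend Subtype.val f 0) X z))
        (fun z hz => (hf.hasFDerivWithinAt ⟨z, hDX hz⟩).mono hDX) fun z hz => ?_
      rw [LinearIsometryEquiv.nnnorm_map, ← ENNReal.coe_le_coe, ← enorm_eq_nnnorm]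
      exact hC ⟨z, hDX hz⟩ hz
    simpa only [extend_coe, edist_eq_enorm_sub (f x), Subtype.edist_eq] using hlip hx hy

theorem DiffOn.enorm_sub_le_lipConst (hf : DiffOn f) (hX : Convex ℝ X) (x y : X) :
    ‖f x - f y‖ₑ ≤ lipConst f * edist x y :=
  hf.enorm_sub_le_of_convex hX subset_rfl (fun z _ => le_iSup (fun z => ‖gradOn f z‖ₑ) z) x.2 y.2

theorem DiffOn.enorm_sub_le_of_interior (hf : DiffOn f) (hX : Convex ℝ X)
    (hint : (interior X).Nonempty) {C : ℝ≥0∞}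
    (hC : ∀ x : X, (x : E d) ∈ interior X → ‖gradOn f x‖ₑ ≤ C) (x y : X) :
    ‖f x - f y‖ₑ ≤ C * edist x y := by
  induction C with
  | top => exact enorm_sub_le_top_mul_edist f x y
  | coe C =>
    set U : Set X := Subtype.val ⁻¹' interior X with hU
    have hlip : LipschitzOnWith C f U := fun x hx y hy => by
      rw [edist_eq_enorm_sub]
      exact hf.enorm_sub_le_of_convex hX.interior interior_subset hC hx hy
    have hdense : Dense U := by
      rw [Subtype.dense_iff, hU, Subtype.image_preimage_coe,
        Set.inter_eq_self_of_subset_right interior_subset,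
        hX.closure_interior_eq_closure_of_nonempty_interior hint]
      exact subset_closure
    have hlip' := (lipschitzOnWith_closure_iff hf.continuous.continuousOn).2 hlip
    rw [← edist_eq_enorm_sub]
    exact hlip' (hdense x) (hdense y)

theorem enorm_le_of_hasFDerivAt {v : E d} (hx : (x : E d) ∈ interior X)
    (hv : HasFDerivAt (Function.extend Subtype.val f 0)
      (InnerProductSpace.toDual ℝ (E d) v) x) {C : ℝ≥0∞}
    (hf : ∀ y, ‖f y - f x‖ₑ ≤ C * edist y x) : ‖v‖ₑ ≤ C := by
  induction C with
  | top => exact le_top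
  | coe C =>
    rw [enorm_eq_nnnorm, ENNReal.coe_le_coe, ← NNReal.coe_le_coe, coe_nnnorm,
      ← (InnerProductSpace.toDual ℝ (E d)).norm_map]
    refine hv.le_of_lip' C.coe_nonneg ?_
    filter_upwards [mem_interior_iff_mem_nhds.1 hx] with z hz
    have hle := ENNReal.toReal_mono (by finiteness) (hf ⟨z, hz⟩)
    rwa [toReal_enorm, ENNReal.toReal_mul, Subtype.edist_eq, edist_eq_enorm_sub z, toReal_enorm,
      ← extend_coe f, ← extend_coe f x] at hle

theorem exists_hasFDerivAt_integral {Ω : Type*} [MeasurableSpace Ω] {ν : Measure Ω}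
    {F : X → Ω → ℝ} {G : Ω → E d} {K : Ω → ℝ≥0∞} (hx : (x : E d) ∈ interior X)
    (hF : ∀ z, Integrable (F z) ν) (hG : AEStronglyMeasurable G ν) (hK : AEMeasurable K ν)
    (hKint : ∫⁻ ω, K ω ∂ν ≠ ∞) (hlip : ∀ z ω, ‖F z ω - F x ω‖ₑ ≤ K ω * edist z x)
    (hdiff : ∀ ω, HasFDerivAt (Function.extend Subtype.val (fun z => F z ω) 0)
      (InnerProductSpace.toDual ℝ (E d) (G ω)) x) :
    ∃ v, HasFDerivAt (Function.extend Subtype.val (fun z => ∫ ω, F z ω ∂ν) 0)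
      (InnerProductSpace.toDual ℝ (E d) v) x := by
  have hX : X ∈ 𝓝 (x : E d) := mem_interior_iff_mem_nhds.1 hx
  have hval (z : X) : (fun ω => Function.extend Subtype.val (fun z => F z ω) (0 : E d → ℝ) z) =
      F z := funext fun ω => extend_coe _ z
  have hderiv := (hasFDerivAt_integral_of_dominated_loc_of_lip' (μ := ν)
    (F := fun z ω => Function.extend Subtype.val (fun z => F z ω) 0 z)
    (bound := fun ω => (K ω).toReal) hX
    (fun z hz => (congrArg (AEStronglyMeasurable · ν) (hval ⟨z, hz⟩)).mpr (hF ⟨z, hz⟩).1)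
    ((congrArg (Integrable · ν) (hval x)).mpr (hF x))
    ((InnerProductSpace.toDual ℝ (E d)).continuous.comp_aestronglyMeasurable hG) ?_
    (integrable_toReal_of_lintegral_ne_top hK hKint) (.of_forall hdiff)).2
  · refine ⟨(InnerProductSpace.toDual ℝ (E d)).symm
      (∫ ω, InnerProductSpace.toDual ℝ (E d) (G ω) ∂ν), ?_⟩
    rw [LinearIsometryEquiv.apply_symm_apply]
    refine hderiv.congr_of_eventuallyEq ?_
    filter_upwards [hX] with z hz
    exact (extend_coe _ ⟨z, hz⟩).trans (congrArg (integral ν) (hval ⟨z, hz⟩)).symm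
  · filter_upwards [ae_lt_top' hK hKint] with ω hω z hz
    have hle := ENNReal.toReal_mono (by finiteness) (hlip ⟨z, hz⟩ ω)
    rwa [toReal_enorm, ENNReal.toReal_mul, Subtype.edist_eq, edist_eq_enorm_sub z, toReal_enorm,
      ← extend_coe (fun z => F z ω), ← extend_coe (fun z => F z ω) x] at hle

theorem extend_sub (f g : X → ℝ) :
    Function.extend Subtype.val (fun x => f x - g x) (0 : E d → ℝ) =
      Function.extend Subtype.val f 0 - Function.extend Subtype.val g 0 := by
  ext z
  by_cases hz : ∃ x : X, (x : E d) = z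
  · obtain ⟨x, rfl⟩ := hz
    simp only [extend_coe, Pi.sub_apply]
  · simp only [Function.extend_apply' _ _ _ hz, Pi.sub_apply, Pi.zero_apply, sub_zero]

theorem DiffOn.sub (hf : DiffOn f) (hg : DiffOn g) : DiffOn fun x => f x - g x := by
  unfold DiffOn
  rw [extend_sub]
  exact DifferentiableOn.sub hf hg

theorem gradOn_sub (hf : DiffOn f) (hg : DiffOn g) (hx : (x : E d) ∈ interior X) :
    gradOn (fun x => f x - g x) x = gradOn f x - gradOn g x := by
  have hsub := (hf.hasFDerivAt hx).sub (hg.hasFDerivAt hx)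
  rw [← extend_sub, ← map_sub] at hsub
  exact (InnerProductSpace.toDual ℝ (E d)).injective (((hf.sub hg).hasFDerivAt hx).unique hsub)

/-- The filter of punctured neighbourhoods of `x` in the intersection of `X` with the line through
`x` in direction `e_j`; it is the filter along which `partialMixW` is taken. -/
def coordNhds (x : X) (j : Fin d) : Filter X :=
  𝓝[{x' : X | x' ≠ x ∧ ∃ h : ℝ, (x' : E d) = (x : E d) + h • EuclideanSpace.single j 1}] x

theorem coordNhds_neBot (hx : (x : E d) ∈ interior X) (j : Fin d) : (coordNhds x j).NeBot := by
  refine mem_closure_iff_nhdsWithin_neBot.1 (Metric.mem_closure_iff.2 fun ε hε => ?_)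
  obtain ⟨δ, hδ, hball⟩ := Metric.mem_nhds_iff.1 (mem_interior_iff_mem_nhds.1 hx)
  obtain ⟨h, hpos, hlt⟩ := exists_between (lt_min hε hδ)
  set y : E d := (x : E d) + h • EuclideanSpace.single j 1 with hy
  have hdist : dist y x = h := by
    simp [hy, norm_smul, abs_of_pos hpos]
  have hyX : y ∈ X := hball (by rw [Metric.mem_ball, hdist]; exact hlt.trans_le (min_le_right _ _))
  refine ⟨⟨y, hyX⟩, ⟨fun heq => ?_, h, rfl⟩, ?_⟩
  · rw [← congrArg Subtype.val heq, dist_self] at hdist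
    exact hpos.ne hdist
  · rw [dist_comm, Subtype.dist_eq, hdist]
    exact hlt.trans_le (min_le_left _ _)

theorem tendsto_enorm_sub_div_edist {v : E d}
    (hv : HasFDerivWithinAt (Function.extend Subtype.val f 0)
      (InnerProductSpace.toDual ℝ (E d) v) X x) (j : Fin d) :
    Tendsto (fun x' => ‖f x' - f x‖ₑ / edist x' x) (coordNhds x j) (𝓝 ‖v j‖ₑ) := by
  have hrem := (hasFDerivWithinAt_iff_tendsto.1 hv).comp
    (tendsto_nhdsWithin_iff.2 ⟨continuous_subtype_val.tendsto x, .of_forall Subtype.prop⟩)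
  have hreal : Tendsto (fun x' : X => ‖f x' - f x‖ / dist x' x) (coordNhds x j) (𝓝 ‖v j‖) := by
    rw [tendsto_iff_norm_sub_tendsto_zero]
    refine squeeze_zero' (.of_forall fun _ => norm_nonneg _) ?_ (hrem.mono_left nhdsWithin_le_nhds)
    filter_upwards [self_mem_nhdsWithin] with x' ⟨hne, h, hx'⟩
    have hnorm : ‖(x' : E d) - x‖ = |h| := by simp [hx', norm_smul]
    have hdist : dist x' x = |h| := (dist_eq_norm (x' : E d) x).trans hnorm
    have hpos : 0 < |h| := hdist ▸ dist_pos.2 hne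
    have hlin : InnerProductSpace.toDual ℝ (E d) v ((x' : E d) - x) = h * v j := by
      simp [hx', EuclideanSpace.inner_single_right]
    have hdiv : ‖v j‖ = ‖h * v j‖ / |h| := by
      rw [norm_mul, Real.norm_eq_abs h, mul_div_cancel_left₀ _ hpos.ne']
    simp only [Function.comp_apply, extend_coe, hlin]
    rw [hnorm, hdist, hdiv, ← sub_div, norm_div, Real.norm_eq_abs |h|, abs_abs, div_eq_inv_mul]
    gcongr
    exact abs_norm_sub_norm_le _ _
  rw [← ofReal_norm]
  refine (ENNReal.tendsto_ofReal hreal).congr' ?_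
  filter_upwards [self_mem_nhdsWithin] with x' ⟨hne, _⟩
  rw [ENNReal.ofReal_div_of_pos (dist_pos.2 hne), ofReal_norm, edist_dist]

theorem enorm_le_of_forall_coord_le {v : E d} {K : Fin d → ℝ≥0∞} {c : ℝ≥0∞}
    (h : ∀ j, ‖v j‖ₑ ≤ K j * c) : ‖v‖ₑ ≤ (∑ j, K j ^ 2) ^ (1 / 2 : ℝ) * c := by
  have hv : ‖v‖ₑ = (∑ j, ‖v j‖ₑ ^ 2) ^ (1 / 2 : ℝ) := by
    rw [← edist_zero_right, EuclideanSpace.edist_eq]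
    simp
  calc ‖v‖ₑ ≤ (∑ j, (K j * c) ^ 2) ^ (1 / 2 : ℝ) := by
        rw [hv]
        gcongr with j
        exact h j
    _ = (∑ j, K j ^ 2) ^ (1 / 2 : ℝ) * c := by
        have hc : (c ^ 2) ^ (1 / 2 : ℝ) = c := by
          rw [← ENNReal.rpow_two, ← ENNReal.rpow_mul, mul_one_div_cancel two_ne_zero,
            ENNReal.rpow_one]
        simp only [mul_pow, ← Finset.sum_mul]
        rw [ENNReal.mul_rpow_of_nonneg _ _ (by norm_num), hc]

end Gradient

section BoundedMeasurable

variable {X Y : Type*} [MeasurableSpace X] [MeasurableSpace Y] {f g : X → ℝ}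

/-- Bounded measurable real functions. They are integrable for every finite measure and stable
under integration against Markov kernels, so that no integrability condition arises for the value
functions of an MDP. -/
structure BoundedMeasurable (f : X → ℝ) : Prop where
  measurable : Measurable f
  bounded : ∃ C, ∀ x, |f x| ≤ C

theorem abs_integral_le_of_forall_abs_le {C : ℝ} (hC : ∀ x, |f x| ≤ C) (ν : Measure X)
    [IsProbabilityMeasure ν] : |∫ x, f x ∂ν| ≤ C := by
  simpa using norm_integral_le_of_norm_le_const (μ := ν) (.of_forall hC : ∀ᵐ x ∂ν, ‖f x‖ ≤ C)

namespace BoundedMeasurable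

theorem integrable (hf : BoundedMeasurable f) (ν : Measure X) [IsFiniteMeasure ν] :
    Integrable f ν := by
  obtain ⟨C, hC⟩ := hf.bounded
  exact .of_bound hf.measurable.aestronglyMeasurable C (.of_forall hC)

theorem exists_forall_abs_integral_le (hf : BoundedMeasurable f) :
    ∃ C, ∀ ν : Measure X, IsProbabilityMeasure ν → |∫ x, f x ∂ν| ≤ C := by
  obtain ⟨C, hC⟩ := hf.bounded
  exact ⟨C, fun ν _ => abs_integral_le_of_forall_abs_le hC ν⟩

theorem comp (hf : BoundedMeasurable f) {φ : Y → X} (hφ : Measurable φ) :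
    BoundedMeasurable fun y => f (φ y) := by
  obtain ⟨C, hC⟩ := hf.bounded
  exact ⟨hf.measurable.comp hφ, C, fun y => hC (φ y)⟩

theorem abs (hf : BoundedMeasurable f) : BoundedMeasurable fun x => |f x| := by
  obtain ⟨C, hC⟩ := hf.bounded
  exact ⟨hf.measurable.abs, C, fun x => (abs_abs (f x)).trans_le (hC x)⟩

theorem add (hf : BoundedMeasurable f) (hg : BoundedMeasurable g) :
    BoundedMeasurable fun x => f x + g x := by
  obtain ⟨C, hC⟩ := hf.bounded
  obtain ⟨D, hD⟩ := hg.bounded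
  exact ⟨hf.measurable.add hg.measurable, C + D,
    fun x => (abs_add_le _ _).trans (add_le_add (hC x) (hD x))⟩

theorem const_mul (hf : BoundedMeasurable f) (c : ℝ) : BoundedMeasurable fun x => c * f x := by
  obtain ⟨C, hC⟩ := hf.bounded
  refine ⟨hf.measurable.const_mul c, |c| * C, fun x => ?_⟩
  rw [abs_mul]
  gcongr
  exact hC x

theorem sub (hf : BoundedMeasurable f) (hg : BoundedMeasurable g) :
    BoundedMeasurable fun x => f x - g x := by
  simpa only [neg_one_mul, ← sub_eq_add_neg] using hf.add (hg.const_mul (-1))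

theorem integral_kernel_prod {f : X × Y → ℝ} (hf : BoundedMeasurable f) (K : Kernel X Y)
    [IsMarkovKernel K] : BoundedMeasurable fun x => ∫ y, f (x, y) ∂(K x) := by
  obtain ⟨C, hC⟩ := hf.bounded
  exact ⟨(hf.measurable.stronglyMeasurable.integral_kernel_prod_right' (κ := K)).measurable, C,
    fun x => abs_integral_le_of_forall_abs_le (fun y => hC (x, y)) (K x)⟩

theorem integral_kernel {f : Y → ℝ} (hf : BoundedMeasurable f) (K : Kernel X Y)
    [IsMarkovKernel K] : BoundedMeasurable fun x => ∫ y, f y ∂(K x) :=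
  (hf.comp measurable_snd).integral_kernel_prod K

theorem integral_bind {f : Y → ℝ} (hf : BoundedMeasurable f) (ν : Measure X)
    [IsProbabilityMeasure ν] (K : Kernel X Y) [IsMarkovKernel K] :
    ∫ y, f y ∂(ν.bind K) = ∫ x, ∫ y, f y ∂(K x) ∂ν := by
  have hcomp := Kernel.integral_comp (hf.integrable ((K ∘ₖ Kernel.const Unit ν) ()))
  rwa [Kernel.comp_apply, Kernel.const_apply] at hcomp

end BoundedMeasurable

end BoundedMeasurable

section Discount

variable {γ C : ℝ}

theorem summable_pow_mul_of_abs_le (h0 : 0 ≤ γ) (h1 : γ < 1) {u : ℕ → ℝ} (hu : ∀ t, |u t| ≤ C) :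
    Summable fun t => γ ^ t * u t := by
  refine ((summable_geometric_of_lt_one h0 h1).mul_right C).of_norm_bounded fun t => ?_
  rw [Real.norm_eq_abs, abs_mul, abs_of_nonneg (pow_nonneg h0 t)]
  exact mul_le_mul_of_nonneg_left (hu t) (pow_nonneg h0 t)

theorem hasSum_pow_mul_sub_mul_succ (h0 : 0 ≤ γ) (h1 : γ < 1) {u : ℕ → ℝ}
    (hu : ∀ t, |u t| ≤ C) : HasSum (fun t => γ ^ t * (u t - γ * u (t + 1))) (u 0) := by
  have hsum := summable_pow_mul_of_abs_le h0 h1 hu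
  have hsucc : Summable fun t => γ ^ (t + 1) * u (t + 1) := (summable_nat_add_iff 1).2 hsum
  have hdiff := hsum.hasSum.sub hsucc.hasSum
  rw [hsum.tsum_eq_zero_add, add_sub_cancel_right, pow_zero, one_mul] at hdiff
  simpa only [mul_sub, pow_succ, mul_assoc] using hdiff

variable {X : Type*} [MeasurableSpace X] {f : ℕ → X → ℝ}

theorem boundedMeasurable_tsum_pow_mul (h0 : 0 ≤ γ) (h1 : γ < 1) (hf : ∀ t, Measurable (f t))
    (hC : ∀ t x, |f t x| ≤ C) : BoundedMeasurable fun x => ∑' t, γ ^ t * f t x := by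
  refine ⟨.tsum fun t => (hf t).const_mul _, (1 - γ)⁻¹ * C, fun x => ?_⟩
  rw [← tsum_geometric_of_lt_one h0 h1, ← tsum_mul_right, ← Real.norm_eq_abs]
  refine tsum_of_norm_bounded ((summable_geometric_of_lt_one h0 h1).mul_right C).hasSum fun t => ?_
  rw [Real.norm_eq_abs, abs_mul, abs_of_nonneg (pow_nonneg h0 t)]
  exact mul_le_mul_of_nonneg_left (hC t x) (pow_nonneg h0 t)

theorem integral_tsum_pow_mul (h0 : 0 ≤ γ) (h1 : γ < 1) (hf : ∀ t, Measurable (f t))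
    (hC : ∀ t x, |f t x| ≤ C) (ν : Measure X) [IsProbabilityMeasure ν] :
    ∫ x, ∑' t, γ ^ t * f t x ∂ν = ∑' t, γ ^ t * ∫ x, f t x ∂ν := by
  have hbm (t : ℕ) : BoundedMeasurable (f t) := ⟨hf t, C, hC t⟩
  have hnorm (t : ℕ) : ∫ x, ‖γ ^ t * f t x‖ ∂ν = γ ^ t * ∫ x, |f t x| ∂ν := by
    simp only [norm_mul, Real.norm_eq_abs, abs_of_nonneg (pow_nonneg h0 t), integral_const_mul]
  rw [← integral_tsum_of_summable_integral_norm fun t => ((hbm t).const_mul _).integrable ν]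
  · simp only [integral_const_mul]
  · simp only [hnorm]
    exact summable_pow_mul_of_abs_le h0 h1 fun t =>
      abs_integral_le_of_forall_abs_le (fun x => (abs_abs _).trans_le (hC t x)) ν

end Discount

instance isMarkovKernel_pow {X : Type*} [MeasurableSpace X] (K : Kernel X X) [IsMarkovKernel K]
    (t : ℕ) : IsMarkovKernel (K ^ t) := by
  induction t with
  | zero => exact inferInstanceAs (IsMarkovKernel (Kernel.id : Kernel X X))
  | succ t ih => exact inferInstanceAs (IsMarkovKernel ((K ^ t) ∘ₖ K))

namespace MDP

variable {n m : ℕ} {S : Set (E n)} {A : Set (E m)} (M : MDP S A) (π π' : Policy S A)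
  (ν : Measure S)

/-- The transition kernel `s ↦ E_{a ∼ π(·|s)} P(s, a)` of the Markov chain of states induced by the
policy `π`. -/
noncomputable def trans : Kernel S S := M.P ∘ₖ (Kernel.id ×ₖ π.toKernel)

instance isMarkovKernel_trans : IsMarkovKernel (M.trans π) := by
  unfold trans
  infer_instance

instance isProbabilityMeasure_step [IsProbabilityMeasure ν] :
    IsProbabilityMeasure (M.step ν π) :=
  inferInstanceAs (IsProbabilityMeasure (ν.bind (M.trans π)))

instance isProbabilityMeasure_steps [IsProbabilityMeasure ν] (t : ℕ) :
    IsProbabilityMeasure (M.steps ν π t) := by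
  induction t with
  | zero => assumption
  | succ t ih => exact M.isProbabilityMeasure_step π _

theorem steps_succ_eq_steps_step (t : ℕ) : M.steps ν π (t + 1) = M.steps (M.step ν π) π t := by
  induction t with
  | zero => rfl
  | succ t ih => exact congrArg (M.step · π) ih

theorem steps_eq_bind_pow (t : ℕ) : M.steps ν π t = ν.bind (M.trans π ^ t) := by
  induction t generalizing ν with
  | zero => exact Measure.bind_dirac.symm
  | succ t ih =>
    rw [steps_succ_eq_steps_step, ih]
    exact Measure.comp_assoc

theorem steps_dirac (s : S) (t : ℕ) : M.steps (Measure.dirac s) π t = (M.trans π ^ t) s := by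
  rw [steps_eq_bind_pow, Measure.dirac_bind (Kernel.measurable _)]

theorem step_dirac (s : S) : M.step (Measure.dirac s) π = M.trans π s :=
  Measure.dirac_bind (Kernel.measurable (M.trans π)) s

/-- The expected one-step reward `s ↦ E_{a ∼ π(·|s)} R(s, a)` of the policy `π`. -/
noncomputable def reward (s : S) : ℝ := ∫ a, M.R (s, a) ∂(π.toKernel s)

theorem abs_R_le (x : S × A) : |M.R x| ≤ M.Rmax :=
  (abs_of_nonneg (M.R_mem x).1).trans_le (M.R_mem x).2

theorem boundedMeasurable_R : BoundedMeasurable M.R := ⟨M.measurable_R, M.Rmax, M.abs_R_le⟩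

theorem boundedMeasurable_reward : BoundedMeasurable (M.reward π) :=
  M.boundedMeasurable_R.integral_kernel_prod π.toKernel

theorem abs_integral_reward_le [IsProbabilityMeasure ν] : |∫ s, M.reward π s ∂ν| ≤ M.Rmax :=
  abs_integral_le_of_forall_abs_le
    (fun s => abs_integral_le_of_forall_abs_le (fun a => M.abs_R_le (s, a)) (π.toKernel s)) ν

theorem V_eq_tsum :
    M.V π = fun s => ∑' t, M.γ ^ t * ∫ s', M.reward π s' ∂((M.trans π ^ t) s) := by
  simp only [funext_iff, V, steps_dirac, reward, implies_true]

theorem boundedMeasurable_V : BoundedMeasurable (M.V π) := by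
  rw [V_eq_tsum]
  exact boundedMeasurable_tsum_pow_mul M.γ_nonneg M.γ_lt_one
    (fun t => ((M.boundedMeasurable_reward π).integral_kernel (M.trans π ^ t)).measurable)
    fun t s => M.abs_integral_reward_le π _

theorem integral_V [IsProbabilityMeasure ν] :
    ∫ s, M.V π s ∂ν = ∑' t, M.γ ^ t * ∫ s, M.reward π s ∂(M.steps ν π t) := by
  rw [V_eq_tsum, integral_tsum_pow_mul M.γ_nonneg M.γ_lt_one
    (fun t => ((M.boundedMeasurable_reward π).integral_kernel (M.trans π ^ t)).measurable)
    fun t s => M.abs_integral_reward_le π _]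
  simp only [steps_eq_bind_pow, (M.boundedMeasurable_reward π).integral_bind ν]

theorem integral_V_step [IsProbabilityMeasure ν] :
    ∫ s, M.V π s ∂(M.step ν π') = ∫ s, ∫ s', M.V π s' ∂(M.trans π' s) ∂ν :=
  (M.boundedMeasurable_V π).integral_bind ν (M.trans π')

theorem V_eq_reward_add (s : S) :
    M.V π s = M.reward π s + M.γ * ∫ s', M.V π s' ∂(M.trans π s) := by
  have hzero : ∫ s', M.reward π s' ∂(M.steps (.dirac s) π 0) = M.reward π s :=
    integral_dirac' _ _ (M.boundedMeasurable_reward π).measurable.stronglyMeasurable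
  have hsum := summable_pow_mul_of_abs_le M.γ_nonneg M.γ_lt_one
    fun t => M.abs_integral_reward_le π (M.steps (.dirac s) π t)
  calc M.V π s = ∑' t, M.γ ^ t * ∫ s', M.reward π s' ∂(M.steps (.dirac s) π t) := rfl
    _ = M.reward π s +
          ∑' t, M.γ ^ (t + 1) * ∫ s', M.reward π s' ∂(M.steps (.dirac s) π (t + 1)) := by
        rw [hsum.tsum_eq_zero_add, hzero, pow_zero, one_mul]
    _ = M.reward π s + M.γ * ∫ s', M.V π s' ∂(M.trans π s) := by
        simp only [integral_V, ← tsum_mul_left, steps_succ_eq_steps_step, step_dirac, pow_succ',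
          mul_assoc]

theorem boundedMeasurable_Q : BoundedMeasurable fun x : S × A => M.Q π x.1 x.2 :=
  M.boundedMeasurable_R.add (((M.boundedMeasurable_V π).integral_kernel M.P).const_mul M.γ)

theorem boundedMeasurable_Q_action (s : S) : BoundedMeasurable fun a : A => M.Q π s a :=
  (M.boundedMeasurable_Q π).comp measurable_prodMk_left

theorem integral_trans {f : S → ℝ} (hf : BoundedMeasurable f) (s : S) :
    ∫ s', f s' ∂(M.trans π s) = ∫ a, ∫ s', f s' ∂(M.P (s, a)) ∂(π.toKernel s) := by
  rw [trans, Kernel.integral_comp (hf.integrable _), Kernel.prod_apply, Kernel.id_apply,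
    integral_prod _ ((hf.integral_kernel M.P).integrable _), integral_dirac]

theorem integral_Q (s : S) :
    ∫ a, M.Q π s a ∂(π'.toKernel s) =
      M.reward π' s + M.γ * ∫ s', M.V π s' ∂(M.trans π' s) := by
  have hR : BoundedMeasurable fun a : A => M.R (s, a) :=
    M.boundedMeasurable_R.comp measurable_prodMk_left
  have hV : BoundedMeasurable fun a : A => ∫ s', M.V π s' ∂(M.P (s, a)) :=
    ((M.boundedMeasurable_V π).integral_kernel M.P).comp measurable_prodMk_left
  unfold Q
  rw [integral_add (hR.integrable _) ((hV.const_mul _).integrable _), integral_const_mul,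
    M.integral_trans π' (M.boundedMeasurable_V π), reward]

theorem V_eq_integral_Q (s : S) : M.V π s = ∫ a, M.Q π s a ∂(π.toKernel s) := by
  rw [integral_Q, ← V_eq_reward_add]

theorem adv_eq_integral_Q_sub (s : S) :
    M.adv π s π' = ∫ a, M.Q π s a ∂(π'.toKernel s) - ∫ a, M.Q π s a ∂(π.toKernel s) := by
  rw [adv, integral_sub ((M.boundedMeasurable_Q_action π s).integrable _) (integrable_const _),
    integral_const, probReal_univ, one_smul, V_eq_integral_Q]

theorem adv_self (s : S) : M.adv π s π = 0 := by
  rw [adv_eq_integral_Q_sub, sub_self]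

theorem boundedMeasurable_adv : BoundedMeasurable fun s => M.adv π s π' := by
  simp only [adv_eq_integral_Q_sub]
  exact ((M.boundedMeasurable_Q π).integral_kernel_prod π'.toKernel).sub
    ((M.boundedMeasurable_Q π).integral_kernel_prod π.toKernel)

theorem integral_adv [IsProbabilityMeasure ν] :
    ∫ s, M.adv π s π' ∂ν = ∫ s, M.reward π' s ∂ν -
      (∫ s, M.V π s ∂ν - M.γ * ∫ s, M.V π s ∂(M.step ν π')) := by
  have hV := M.boundedMeasurable_V π
  have hr := M.boundedMeasurable_reward π'
  have hT := (hV.integral_kernel (M.trans π')).const_mul M.γ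
  simp only [adv_eq_integral_Q_sub, ← V_eq_integral_Q, integral_Q]
  rw [integral_sub ((hr.add hT).integrable ν) (hV.integrable ν),
    integral_add (hr.integrable ν) (hT.integrable ν), integral_const_mul, ← integral_V_step]
  ring

/-- The performance difference formula of Kakade and Langford. -/
theorem payoff_sub_payoff :
    M.payoff π' - M.payoff π = ∑' t, M.γ ^ t * ∫ s, M.adv π s π' ∂(M.steps M.μ π' t) := by
  obtain ⟨C, hC⟩ := (M.boundedMeasurable_V π).exists_forall_abs_integral_le
  set u : ℕ → ℝ := fun t => ∫ s, M.V π s ∂(M.steps M.μ π' t)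
  have hrewards := summable_pow_mul_of_abs_le M.γ_nonneg M.γ_lt_one
    fun t => M.abs_integral_reward_le π' (M.steps M.μ π' t)
  have hvalues : HasSum (fun t => M.γ ^ t * (u t - M.γ * u (t + 1))) (u 0) :=
    hasSum_pow_mul_sub_mul_succ M.γ_nonneg M.γ_lt_one fun t => hC _ inferInstance
  have hterm (t : ℕ) : M.γ ^ t * ∫ s, M.adv π s π' ∂(M.steps M.μ π' t) =
      M.γ ^ t * ∫ s, M.reward π' s ∂(M.steps M.μ π' t) - M.γ ^ t * (u t - M.γ * u (t + 1)) := by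
    rw [integral_adv, mul_sub]
    rfl
  rw [tsum_congr hterm, hrewards.tsum_sub hvalues.summable, hvalues.tsum_eq, ← integral_V]
  rfl

theorem integral_adv_visit :
    (1 - M.γ)⁻¹ * ∫ s, M.adv π s π' ∂(M.visit M.μ π) =
      ∑' t, M.γ ^ t * ∫ s, M.adv π s π' ∂(M.steps M.μ π t) := by
  have hγ : 0 < 1 - M.γ := sub_pos.2 M.γ_lt_one
  have hw (t : ℕ) : (ENNReal.ofReal ((1 - M.γ) * M.γ ^ t)).toReal = (1 - M.γ) * M.γ ^ t :=
    ENNReal.toReal_ofReal (mul_nonneg hγ.le (pow_nonneg M.γ_nonneg t))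
  have hadv := M.boundedMeasurable_adv π π'
  have hint : Integrable (fun s => M.adv π s π') (M.visit M.μ π) := by
    obtain ⟨C, hC⟩ := hadv.abs.exists_forall_abs_integral_le
    refine integrable_sum_measure
      (fun t => (hadv.integrable _).smul_measure ENNReal.ofReal_ne_top) ?_
    simp only [integral_smul_measure, hw, smul_eq_mul, mul_assoc]
    exact (summable_pow_mul_of_abs_le M.γ_nonneg M.γ_lt_one
      fun t => hC (M.steps M.μ π t) inferInstance).mul_left _
  unfold visit at hint ⊢
  simp only [integral_sum_measure hint, ← tsum_mul_left, integral_smul_measure, hw, smul_eq_mul,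
    mul_assoc, inv_mul_cancel_left₀ hγ.ne']

end MDP

section ENNReal

theorem one_add_mul_inv_one_sub (q : ℝ≥0∞) : 1 + q * (1 - q)⁻¹ = (1 - q)⁻¹ := by
  have hsplit : ∑' k : ℕ, q ^ k = 1 + q * ∑' k : ℕ, q ^ k := by
    rw [← ENNReal.tsum_mul_left, tsum_eq_zero_add' ENNReal.summable, pow_zero]
    simp only [pow_succ']
  rw [← ENNReal.tsum_geometric, ← hsplit]

/-- The partial sums `x N` of `∑ g ^ t * w t` satisfy
`x (N + 1) ≤ g * b * (1 - g)⁻¹ + g * q * x N`, whose fixed point is the bound. -/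
theorem tsum_pow_mul_le_of_le_add {g b q : ℝ≥0∞} {w : ℕ → ℝ≥0∞} (h0 : w 0 = 0)
    (hw : ∀ t, w (t + 1) ≤ b + q * w t) :
    ∑' t, g ^ t * w t ≤ g * b * (1 - g)⁻¹ * (1 - g * q)⁻¹ := by
  rw [ENNReal.tsum_eq_iSup_nat]
  refine iSup_le fun N => ?_
  induction N with
  | zero => simp
  | succ N ih =>
    have hgeom : ∑ t ∈ Finset.range N, g ^ t ≤ (1 - g)⁻¹ := by
      rw [← ENNReal.tsum_geometric]
      exact ENNReal.sum_le_tsum _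
    calc ∑ t ∈ Finset.range (N + 1), g ^ t * w t
        = ∑ t ∈ Finset.range N, g ^ (t + 1) * w (t + 1) := by
          rw [Finset.sum_range_succ', h0, mul_zero, add_zero]
      _ ≤ ∑ t ∈ Finset.range N, g ^ (t + 1) * (b + q * w t) := by
          gcongr with t
          exact hw t
      _ = g * b * ∑ t ∈ Finset.range N, g ^ t + g * q * ∑ t ∈ Finset.range N, g ^ t * w t := by
          rw [Finset.mul_sum, Finset.mul_sum, ← Finset.sum_add_distrib]
          exact Finset.sum_congr rfl fun t _ => by ring
      _ ≤ g * b * (1 - g)⁻¹ + g * q * (g * b * (1 - g)⁻¹ * (1 - g * q)⁻¹) := by gcongr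
      _ = g * b * (1 - g)⁻¹ * (1 + g * q * (1 - g * q)⁻¹) := by ring
      _ = g * b * (1 - g)⁻¹ * (1 - g * q)⁻¹ := by rw [one_add_mul_inv_one_sub]

theorem le_sInf_setOf_eq_mul {a b L : ℝ≥0∞} (hb : b ≠ ∞) (hab : a ≤ L * b) :
    a ≤ sInf {x | a = x * b} * b := by
  rcases eq_or_ne b 0 with rfl | hb0
  · simpa using hab
  · have hsingleton : {x | a = x * b} = {a / b} := by
      ext x
      rw [Set.mem_ofPred_eq, Set.mem_singleton_iff, ENNReal.eq_div_iff hb0 hb, mul_comm, eq_comm]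
    rw [hsingleton, csInf_singleton, ENNReal.div_mul_cancel hb0 hb]

theorem ofReal_div_one_sub {q : ℝ} (h0 : 0 ≤ q) (h1 : q < 1) :
    ENNReal.ofReal (q / (1 - q)) = ENNReal.ofReal q * (1 - ENNReal.ofReal q)⁻¹ := by
  rw [ENNReal.ofReal_div_of_pos (sub_pos.2 h1), ENNReal.ofReal_sub _ h0, ENNReal.ofReal_one,
    div_eq_mul_inv]

end ENNReal

namespace MDP

variable {n m : ℕ} {S : Set (E n)} {A : Set (E m)} (M : MDP S A)

theorem CLt_succ (ν : Measure S) (π₁ π₂ : Policy S A) (t : ℕ) :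
    M.CLt ν π₁ π₂ (t + 1) =
      M.hatL ν π₁ π₂ t + M.tildeL ν π₁ π₂ t * M.CLt ν π₁ π₂ t := by
  have hprod (k : ℕ) : ∏ i ∈ Finset.Icc 1 (k + 1), M.tildeL ν π₁ π₂ (t + 1 - i) =
      M.tildeL ν π₁ π₂ t * ∏ i ∈ Finset.Icc 1 k, M.tildeL ν π₁ π₂ (t - i) := by
    simp only [← Finset.Ico_add_one_right_eq_Icc, Finset.prod_Ico_eq_prod_range]
    rw [Nat.add_sub_cancel, Nat.add_sub_cancel, Finset.prod_range_succ', mul_comm]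
    congr 1
    exact Finset.prod_congr rfl fun i _ => by congr 1; omega
  unfold CLt
  simp only [← Finset.Ico_add_one_right_eq_Icc _ (t + 1), ← Finset.Ico_add_one_right_eq_Icc _ t,
    Finset.sum_Ico_eq_sum_range, Nat.add_sub_cancel, Nat.add_sub_cancel_left]
  rw [Finset.sum_range_succ', Finset.mul_sum, add_comm]
  congr 1
  · simp
  · refine Finset.sum_congr rfl fun k _ => ?_
    rw [hprod, add_comm 1 (k + 1), Nat.add_sub_add_right, add_comm 1 k]
    ring

section Divergence

variable {M} {Pol : Set (Policy S A)} {Lπ Lμ : ℝ≥0} {π₁ π₂ : Policy S A}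

theorem wass_steps_succ_le [StandardBorelSpace S] (ν : Measure S) [IsProbabilityMeasure ν]
    (π₁ π₂ : Policy S A) (t : ℕ) :
    wass (M.steps ν π₁ (t + 1)) (M.steps ν π₂ (t + 1)) ≤
      wass (M.step (M.steps ν π₁ t) π₁) (M.step (M.steps ν π₁ t) π₂) +
        wass (M.step (M.steps ν π₁ t) π₂) (M.step (M.steps ν π₂ t) π₂) :=
  wass_triangle _ _ _

variable [StandardBorelSpace S] (hLπ : M.LipschitzPolicy Pol Lπ) (hLμ : M.LipschitzState Pol Lμ)
  (h₁ : π₁ ∈ Pol) (h₂ : π₂ ∈ Pol) (ν : Measure S) [IsProbabilityMeasure ν]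

include hLπ hLμ h₁ h₂

theorem wass_steps_succ_le_add (t : ℕ) :
    wass (M.steps ν π₁ (t + 1)) (M.steps ν π₂ (t + 1)) ≤
      Lπ * policyW π₁ π₂ + Lμ * wass (M.steps ν π₁ t) (M.steps ν π₂ t) :=
  (wass_steps_succ_le ν π₁ π₂ t).trans
    (add_le_add (hLπ _ inferInstance π₁ h₁ π₂ h₂) (hLμ _ _ inferInstance inferInstance π₂ h₂))

theorem wass_steps_ne_top (hW : policyW π₁ π₂ ≠ ∞) (t : ℕ) :
    wass (M.steps ν π₁ t) (M.steps ν π₂ t) ≠ ∞ := by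
  induction t with
  | zero => simp [steps]
  | succ t ih =>
    exact ne_top_of_le_ne_top (by finiteness) (wass_steps_succ_le_add hLπ hLμ h₁ h₂ ν t)

theorem wass_steps_le_CLt (hW : policyW π₁ π₂ ≠ ∞) (t : ℕ) :
    wass (M.steps ν π₁ t) (M.steps ν π₂ t) ≤ M.CLt ν π₁ π₂ t * policyW π₁ π₂ := by
  induction t with
  | zero => simp [steps]
  | succ t ih =>
    have hpolicy : wass (M.step (M.steps ν π₁ t) π₁) (M.step (M.steps ν π₁ t) π₂) ≤
        M.hatL ν π₁ π₂ t * policyW π₁ π₂ :=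
      le_sInf_setOf_eq_mul hW (hLπ _ inferInstance π₁ h₁ π₂ h₂)
    have hstate : wass (M.step (M.steps ν π₁ t) π₂) (M.step (M.steps ν π₂ t) π₂) ≤
        M.tildeL ν π₁ π₂ t * wass (M.steps ν π₁ t) (M.steps ν π₂ t) :=
      le_sInf_setOf_eq_mul (wass_steps_ne_top hLπ hLμ h₁ h₂ ν hW t)
        (hLμ _ _ inferInstance inferInstance π₂ h₂)
    calc wass (M.steps ν π₁ (t + 1)) (M.steps ν π₂ (t + 1))
        ≤ M.hatL ν π₁ π₂ t * policyW π₁ π₂ +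
            M.tildeL ν π₁ π₂ t * wass (M.steps ν π₁ t) (M.steps ν π₂ t) :=
          (wass_steps_succ_le ν π₁ π₂ t).trans (add_le_add hpolicy hstate)
      _ ≤ M.hatL ν π₁ π₂ t * policyW π₁ π₂ +
            M.tildeL ν π₁ π₂ t * (M.CLt ν π₁ π₂ t * policyW π₁ π₂) := by gcongr
      _ = M.CLt ν π₁ π₂ (t + 1) * policyW π₁ π₂ := by rw [CLt_succ, add_mul, mul_assoc]

theorem wass_steps_le_CL (hW : policyW π₁ π₂ ≠ ∞) (t : ℕ) :
    wass (M.steps ν π₁ t) (M.steps ν π₂ t) ≤ M.CL Pol * policyW π₁ π₂ := by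
  refine (wass_steps_le_CLt hLπ hLμ h₁ h₂ ν hW t).trans (mul_le_mul_left ?_ _)
  unfold CL
  exact le_iSup₂_of_le ν inferInstance <| le_iSup₂_of_le π₁ h₁ <| le_iSup₂_of_le π₂ h₂ <|
    le_iSup (M.CLt ν π₁ π₂) t

theorem tsum_discount_wass_steps_le {κ : ℝ≥0∞} (hκ : M.IsAmplification Pol Lπ Lμ κ) :
    ∑' t, ENNReal.ofReal M.γ ^ t * wass (M.steps ν π₁ t) (M.steps ν π₂ t) ≤
      ENNReal.ofReal (M.γ / (1 - M.γ)) * κ * policyW π₁ π₂ := by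
  have h0 : wass (M.steps ν π₁ 0) (M.steps ν π₂ 0) = 0 := wass_self ν
  rw [ofReal_div_one_sub M.γ_nonneg M.γ_lt_one]
  rcases hκ with ⟨hlt, rfl⟩ | ⟨hW, -, rfl⟩
  · have hκ : ENNReal.ofReal (Lπ / (1 - M.γ * Lμ)) = Lπ * (1 - ENNReal.ofReal M.γ * Lμ)⁻¹ := by
      rw [ENNReal.ofReal_div_of_pos (sub_pos.2 hlt),
        ENNReal.ofReal_sub _ (mul_nonneg M.γ_nonneg Lμ.coe_nonneg), ENNReal.ofReal_mul M.γ_nonneg,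
        ENNReal.ofReal_one, ENNReal.ofReal_coe_nnreal, ENNReal.ofReal_coe_nnreal, div_eq_mul_inv]
    refine (tsum_pow_mul_le_of_le_add h0 (wass_steps_succ_le_add hLπ hLμ h₁ h₂ ν)).trans_eq ?_
    rw [hκ]
    ring
  · have hw (t : ℕ) : wass (M.steps ν π₁ (t + 1)) (M.steps ν π₂ (t + 1)) ≤
        M.CL Pol * policyW π₁ π₂ + 0 * wass (M.steps ν π₁ t) (M.steps ν π₂ t) := by
      simpa using wass_steps_le_CL hLπ hLμ h₁ h₂ ν (hW _ h₁ _ h₂) (t + 1)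
    refine (tsum_pow_mul_le_of_le_add h0 hw).trans_eq ?_
    rw [mul_zero, tsub_zero, inv_one, mul_one]
    ring

end Divergence

end MDP

section Mix

variable {X : Type*} [MeasurableSpace X] {ζ ν : Measure X}

instance isProbabilityMeasure_mix [IsProbabilityMeasure ζ] [IsProbabilityMeasure ν] :
    IsProbabilityMeasure (mix ζ ν) := by
  constructor
  rw [mix, Measure.smul_apply, Measure.add_apply, measure_univ, measure_univ, smul_eq_mul,
    one_add_one_eq_two, ENNReal.inv_mul_cancel two_ne_zero ENNReal.ofNat_ne_top]

theorem integral_mix {f : X → ℝ} (hζ : Integrable f ζ) (hν : Integrable f ν) :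
    ∫ x, f x ∂(mix ζ ν) = 2⁻¹ * (∫ x, f x ∂ζ + ∫ x, f x ∂ν) := by
  rw [mix, integral_smul_measure, integral_add_measure hζ hν]
  simp

end Mix

namespace MDP

section FrozenAdvantage

variable {n m : ℕ} {S : Set (E n)} {A : Set (E m)} (M : MDP S A) (π π' : Policy S A)

/-- The advantage of `π'` over `π` with both action distributions frozen at the state `s`; only the
state `z` at which the action values of `π` are evaluated moves. It isolates the part of the
variation of `s ↦ A^π(s, π')` that is due to `∇_s Q^π`. -/
noncomputable def frozenAdv (s z : S) : ℝ :=
  ∫ a, M.Q π z a ∂(π'.toKernel s) - ∫ a, M.Q π z a ∂(π.toKernel s)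

theorem frozenAdv_self (s : S) : M.frozenAdv π π' s s = M.adv π s π' :=
  (M.adv_eq_integral_Q_sub π π' s).symm

theorem frozenAdv_sub_frozenAdv (s z z' : S) :
    M.frozenAdv π π' s z - M.frozenAdv π π' s z' =
      ∫ a, (M.Q π z a - M.Q π z' a) ∂(π'.toKernel s) -
        ∫ a, (M.Q π z a - M.Q π z' a) ∂(π.toKernel s) := by
  have hint (z : S) (ν : Measure A) [IsProbabilityMeasure ν] : Integrable (M.Q π z) ν :=
    (M.boundedMeasurable_Q_action π z).integrable ν
  rw [integral_sub (hint z _) (hint z' _), integral_sub (hint z _) (hint z' _), frozenAdv,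
    frozenAdv]
  ring

theorem adv_sub_frozenAdv (s z : S) :
    M.adv π z π' - M.frozenAdv π π' s z =
      2 * (∫ a, M.Q π z a ∂(mix (π'.toKernel z) (π.toKernel s)) -
        ∫ a, M.Q π z a ∂(mix (π'.toKernel s) (π.toKernel z))) := by
  have hint (ν : Measure A) [IsProbabilityMeasure ν] : Integrable (M.Q π z) ν :=
    (M.boundedMeasurable_Q_action π z).integrable ν
  rw [integral_mix (hint _) (hint _), integral_mix (hint _) (hint _), adv_eq_integral_Q_sub,
    frozenAdv]
  ring

end FrozenAdvantage

namespace Regular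

variable {n m : ℕ} {S : Set (E n)} {A : Set (E m)} {M : MDP S A} {Pol : Set (Policy S A)}
  {π π' : Policy S A}

theorem enorm_Q_sub_le (hreg : M.Regular Pol) (hA : Convex ℝ A) (hπ : π ∈ Pol) (s : S)
    (a a' : A) : ‖M.Q π s a - M.Q π s a'‖ₑ ≤ M.lipQ π * edist a a' :=
  ((hreg.diff_action π hπ s).enorm_sub_le_lipConst hA a a').trans
    (mul_le_mul_left (le_iSup (fun s => lipConst fun a : A => M.Q π s a) s) _)

theorem enorm_gradOn_Q_sub_le (hreg : M.Regular Pol) (hA : Convex ℝ A) (hπ : π ∈ Pol) (s : S)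
    (a a' : A) :
    ‖gradOn (fun z : S => M.Q π z a) s - gradOn (fun z : S => M.Q π z a') s‖ₑ ≤
      M.lipGradQ π * edist a a' :=
  (enorm_le_of_forall_coord_le fun j =>
    (hreg.diff_mixed π hπ s j).enorm_sub_le_lipConst hA a a').trans
    (mul_le_mul_left (le_iSup (fun s : S => (∑ j : Fin n,
      lipConst (fun a : A => gradOn (fun z : S => M.Q π z a) s j) ^ 2) ^ (1 / 2 : ℝ)) s) _)

theorem continuous_gradOn_Q (hreg : M.Regular Pol) (hA : Convex ℝ A) (hπ : π ∈ Pol) (s : S) :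
    Continuous fun a : A => gradOn (fun z : S => M.Q π z a) s := by
  refine LipschitzWith.continuous (K := (M.lipGradQ π).toNNReal) fun a a' => ?_
  rw [ENNReal.coe_toNNReal (hreg.lipGradQ_ne_top π hπ), edist_eq_enorm_sub]
  exact hreg.enorm_gradOn_Q_sub_le hA hπ s a a'

theorem enorm_Q_sub_sub_le (hreg : M.Regular Pol) (hS : Convex ℝ S)
    (hSint : (interior S).Nonempty) (hA : Convex ℝ A) (hπ : π ∈ Pol) (z z' : S) (a a' : A) :
    ‖(M.Q π z a - M.Q π z a') - (M.Q π z' a - M.Q π z' a')‖ₑ ≤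
      M.lipGradQ π * edist a a' * edist z z' := by
  have hdiff := hreg.diff_state π hπ
  refine ((hdiff a).sub (hdiff a')).enorm_sub_le_of_interior hS hSint (fun x hx => ?_) z z'
  rw [gradOn_sub (hdiff a) (hdiff a') hx]
  exact hreg.enorm_gradOn_Q_sub_le hA hπ x a a'

theorem enorm_frozenAdv_sub_le (hreg : M.Regular Pol) (hS : Convex ℝ S)
    (hSint : (interior S).Nonempty) (hA : Convex ℝ A) (hπ : π ∈ Pol) (s z z' : S) :
    ‖M.frozenAdv π π' s z - M.frozenAdv π π' s z'‖ₑ ≤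
      M.lipGradQ π * wass (π'.toKernel s) (π.toKernel s) * edist z z' := by
  have hQ := (M.boundedMeasurable_Q_action π z).sub (M.boundedMeasurable_Q_action π z')
  rw [frozenAdv_sub_frozenAdv, mul_right_comm]
  refine enorm_integral_sub_le_wass (hQ.integrable _) (hQ.integrable _) fun a a' => ?_
  rw [sub_sub_sub_comm, mul_right_comm]
  exact hreg.enorm_Q_sub_sub_le hS hSint hA hπ z z' a a'

theorem exists_hasFDerivAt_frozenAdv (hreg : M.Regular Pol) (hS : Convex ℝ S) (hA : Convex ℝ A)
    (hπ : π ∈ Pol) {s : S} (hs : (s : E n) ∈ interior S)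
    (hW : M.lipGradQ π * wass (π'.toKernel s) (π.toKernel s) ≠ ∞) :
    ∃ v, HasFDerivAt (Function.extend Subtype.val (M.frozenAdv π π' s) 0)
      (InnerProductSpace.toDual ℝ (E n) v) s := by
  have hℓ := hreg.lipGradQ_ne_top π hπ
  rw [mul_wass hℓ, ← lt_top_iff_ne_top] at hW
  obtain ⟨c, hW⟩ := iInf_lt_iff.1 hW
  obtain ⟨hc, hW⟩ := iInf_lt_iff.1 hW
  have := hc.isFiniteMeasure
  have hQ (z : S) := M.boundedMeasurable_Q_action π z
  have hgrad := (hreg.continuous_gradOn_Q hA hπ s).measurable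
  have hcoupled : M.frozenAdv π π' s = fun z => ∫ p, (M.Q π z p.1 - M.Q π z p.2) ∂c :=
    funext fun z => hc.integral_sub ((hQ z).integrable _) ((hQ z).integrable _)
  rw [hcoupled]
  refine exists_hasFDerivAt_integral hs (K := fun p => M.lipGradQ π * edist p.1 p.2)
    (G := fun p => gradOn (fun z : S => M.Q π z p.1) s - gradOn (fun z : S => M.Q π z p.2) s)
    (fun z => ?_) ?_ (by fun_prop) ?_
    (fun z p => hreg.enorm_Q_sub_sub_le hS ⟨s, hs⟩ hA hπ z s p.1 p.2) fun p => ?_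
  · exact (((hQ z).comp measurable_fst).sub ((hQ z).comp measurable_snd)).integrable c
  · exact ((hgrad.comp measurable_fst).sub (hgrad.comp measurable_snd)).aestronglyMeasurable
  · rw [lintegral_const_mul' _ _ hℓ]
    exact hW.ne
  · rw [extend_sub, map_sub]
    exact ((hreg.diff_state π hπ p.1).hasFDerivAt hs).sub
      ((hreg.diff_state π hπ p.2).hasFDerivAt hs)

theorem enorm_adv_sub_frozenAdv_le (hreg : M.Regular Pol) (hA : Convex ℝ A) (hπ : π ∈ Pol)
    (s z : S) :
    ‖M.adv π z π' - M.frozenAdv π π' s z‖ₑ ≤ 2 * M.lipQ π * mixW π π' s z := by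
  have hQ := M.boundedMeasurable_Q_action π z
  have htwo : ‖(2 : ℝ)‖ₑ = 2 := by simp [← ofReal_norm]
  rw [adv_sub_frozenAdv, enorm_mul, htwo, mul_assoc]
  gcongr
  exact enorm_integral_sub_le_wass (hQ.integrable _) (hQ.integrable _)
    (hreg.enorm_Q_sub_le hA hπ z)

theorem enorm_gradOn_adv_le (hreg : M.Regular Pol) (hS : Convex ℝ S) (hA : Convex ℝ A)
    (hπ : π ∈ Pol) (hπ' : π' ∈ Pol) {s : S} (hs : (s : E n) ∈ interior S) :
    ‖gradOn (fun s => M.adv π s π') s‖ₑ ≤ 2 * M.lipQ π * LG2 π π' s ^ (1 / 2 : ℝ) +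
      M.lipGradQ π * wass (π'.toKernel s) (π.toKernel s) := by
  rcases eq_or_ne (M.lipGradQ π * wass (π'.toKernel s) (π.toKernel s)) ∞ with hW | hW
  · simp [hW]
  obtain ⟨v, hv⟩ := hreg.exists_hasFDerivAt_frozenAdv hS hA hπ hs hW
  have hfrozen : ‖v‖ₑ ≤ M.lipGradQ π * wass (π'.toKernel s) (π.toKernel s) :=
    enorm_le_of_hasFDerivAt hs hv fun z => hreg.enorm_frozenAdv_sub_le hS ⟨s, hs⟩ hA hπ s z s
  set w := gradOn (fun s => M.adv π s π') s
  have hrest := ((hreg.diff_adv π hπ π' hπ').hasFDerivAt hs).sub hv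
  rw [← extend_sub, ← map_sub] at hrest
  have hℓ : 2 * M.lipQ π ≠ ∞ := ENNReal.mul_ne_top ENNReal.ofNat_ne_top (hreg.lipQ_ne_top π hπ)
  have hcoord (j : Fin n) : ‖(w - v) j‖ₑ ≤ partialMixW π π' s j * (2 * M.lipQ π) := by
    have := coordNhds_neBot hs j
    have hlim := tendsto_enorm_sub_div_edist hrest.hasFDerivWithinAt j
    rw [← hlim.limsup_eq, mul_comm]
    refine (limsup_le_limsup (.of_forall fun z => ?_)).trans_eq
      (ENNReal.limsup_const_mul_of_ne_top hℓ)
    rw [frozenAdv_self, sub_self, sub_zero, ← mul_div_assoc]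
    gcongr
    exact hreg.enorm_adv_sub_frozenAdv_le hA hπ s z
  calc ‖w‖ₑ = ‖(w - v) + v‖ₑ := by rw [sub_add_cancel]
    _ ≤ ‖w - v‖ₑ + ‖v‖ₑ := enorm_add_le _ _
    _ ≤ 2 * M.lipQ π * LG2 π π' s ^ (1 / 2 : ℝ) +
        M.lipGradQ π * wass (π'.toKernel s) (π.toKernel s) := by
      refine add_le_add ((enorm_le_of_forall_coord_le hcoord).trans_eq ?_) hfrozen
      rw [mul_comm, LG2]

theorem enorm_adv_sub_le (hreg : M.Regular Pol) (hS : Convex ℝ S)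
    (hSint : (interior S).Nonempty) (hA : Convex ℝ A) (hπ : π ∈ Pol) (hπ' : π' ∈ Pol)
    (s s' : S) :
    ‖M.adv π s π' - M.adv π s' π'‖ₑ ≤
      (2 * M.lipQ π * (⨆ s, LG2 π π' s) ^ (1 / 2 : ℝ) + M.lipGradQ π * policyW π π') *
        edist s s' := by
  refine (hreg.diff_adv π hπ π' hπ').enorm_sub_le_of_interior hS hSint (fun z hz => ?_) s s'
  refine (hreg.enorm_gradOn_adv_le hS hA hπ hπ' hz).trans ?_
  rw [wass_comm]
  gcongr
  · exact le_iSup (LG2 π π') z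
  · exact le_iSup (fun s => wass (π.toKernel s) (π'.toKernel s)) z

end Regular

end MDP

section Surrogate

theorem rpow_half_sq (x : ℝ≥0∞) : (x ^ (1 / 2 : ℝ)) ^ 2 = x := by
  rw [← ENNReal.rpow_two, ← ENNReal.rpow_mul, one_div_mul_cancel two_ne_zero, ENNReal.rpow_one]

/-- Young's inequality applied to `|α| * x` and `|α|⁻¹ * y`. -/
theorem mul_le_young (x y : ℝ≥0∞) {α : ℝ} (hα : α ≠ 0) :
    x * y ≤ ENNReal.ofReal (α ^ 2 / 2) * x ^ 2 + ENNReal.ofReal (1 / (2 * α ^ 2)) * y ^ 2 := by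
  set c := ENNReal.ofReal |α| with hc
  have hc0 : c ≠ 0 := (ENNReal.ofReal_pos.2 (abs_pos.2 hα)).ne'
  have hsq : c ^ 2 = ENNReal.ofReal (α ^ 2) := by
    rw [hc, ← ENNReal.ofReal_pow (abs_nonneg α), sq_abs]
  have hleft : ENNReal.ofReal (α ^ 2 / 2) = c ^ 2 / 2 := by
    rw [hsq, ENNReal.ofReal_div_of_pos two_pos, ENNReal.ofReal_ofNat]
  have hright : ENNReal.ofReal (1 / (2 * α ^ 2)) = c⁻¹ ^ 2 / 2 := by
    rw [← ENNReal.inv_pow, hsq, ← ENNReal.ofReal_inv_of_pos (by positivity), one_div, mul_inv_rev,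
      ← div_eq_mul_inv, ENNReal.ofReal_div_of_pos two_pos, ENNReal.ofReal_ofNat]
  calc x * y = c * x * (c⁻¹ * y) := by
        rw [mul_mul_mul_comm, ENNReal.mul_inv_cancel hc0 ENNReal.ofReal_ne_top, one_mul]
    _ ≤ (c * x) ^ 2 / 2 + (c⁻¹ * y) ^ 2 / 2 := by
        simpa using ENNReal.young_inequality (c * x) (c⁻¹ * y) Real.HolderConjugate.two_two
    _ = c ^ 2 / 2 * x ^ 2 + c⁻¹ ^ 2 / 2 * y ^ 2 := by
        simp only [div_eq_mul_inv]
        ring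
    _ = _ := by rw [hleft, hright]

theorem coe_sub_le_of_enorm_sub_le {x y : ℝ} {p : ℝ≥0∞} (h : ‖x - y‖ₑ ≤ p) :
    (x : EReal) - (p : EReal) ≤ (y : EReal) := by
  induction p with
  | top => simp
  | coe p =>
    rw [enorm_eq_nnnorm, ENNReal.coe_le_coe, ← NNReal.coe_le_coe, coe_nnnorm] at h
    rw [EReal.coe_nnreal_eq_coe_real, ← EReal.coe_sub, EReal.coe_le_coe_iff]
    exact sub_le_comm.1 ((le_abs_self _).trans h)

theorem monotone_of_isMaxOn_minorant {X R : Type*} [Preorder R] {D : Set X} {f : X → R}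
    {L : ℕ → X → R} {x : ℕ → X} (hx : ∀ k, x k ∈ D) (hL : ∀ k, ∀ y ∈ D, L k y ≤ f y)
    (hself : ∀ k, f (x k) ≤ L k (x k)) (hmax : ∀ k, IsMaxOn (L k) D (x (k + 1))) :
    Monotone fun k => f (x k) :=
  monotone_nat_of_le_succ fun k =>
    calc f (x k) ≤ L k (x k) := hself k
      _ ≤ L k (x (k + 1)) := hmax k (hx k)
      _ ≤ f (x (k + 1)) := hL k _ (hx (k + 1))

variable {n m : ℕ} {S : Set (E n)} {A : Set (E m)}

theorem policyW_sq (π₁ π₂ : Policy S A) :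
    policyW π₁ π₂ ^ 2 = ⨆ s : S, wass (π₂.toKernel s) (π₁.toKernel s) ^ 2 := by
  rw [policyW, ENNReal.iSup_pow_of_ne_zero two_ne_zero]
  simp only [wass_comm]

theorem mixW_self (π : Policy S A) (s s' : S) : mixW π π s s' = 0 := by
  rw [mixW, mix, mix, add_comm, wass_self]

theorem LG2_self (π : Policy S A) (s : S) : LG2 π π s = 0 := by
  have hpartial (j : Fin n) : partialMixW π π s j = 0 := by
    simp only [partialMixW, mixW_self, ENNReal.zero_div]
    exact limsup_const_bot
  simp only [LG2, hpartial, zero_pow two_ne_zero, Finset.sum_const_zero]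

namespace MDP

variable (M : MDP S A)

theorem surrogate_self (κ : ℝ≥0∞) (α : ℝ) (π : Policy S A) :
    M.surrogate κ α π π = (M.payoff π : EReal) := by
  simp [surrogate, adv_self, LG2_self]

theorem enorm_payoff_add_sub_payoff_le (π π' : Policy S A) :
    ‖(M.payoff π + (1 - M.γ)⁻¹ * ∫ s, M.adv π s π' ∂(M.visit M.μ π)) - M.payoff π'‖ₑ ≤
      ∑' t, ENNReal.ofReal M.γ ^ t *
        ‖∫ s, M.adv π s π' ∂(M.steps M.μ π t) - ∫ s, M.adv π s π' ∂(M.steps M.μ π' t)‖ₑ := by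
  obtain ⟨C, hC⟩ := (M.boundedMeasurable_adv π π').exists_forall_abs_integral_le
  have hsum (ψ : Policy S A) : Summable fun t => M.γ ^ t * ∫ s, M.adv π s π' ∂(M.steps M.μ ψ t) :=
    summable_pow_mul_of_abs_le M.γ_nonneg M.γ_lt_one fun t => hC _ inferInstance
  have hdiff : (M.payoff π + (1 - M.γ)⁻¹ * ∫ s, M.adv π s π' ∂(M.visit M.μ π)) - M.payoff π' =
      ∑' t, M.γ ^ t *
        (∫ s, M.adv π s π' ∂(M.steps M.μ π t) - ∫ s, M.adv π s π' ∂(M.steps M.μ π' t)) := by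
    simp only [mul_sub]
    rw [(hsum π).tsum_sub (hsum π'), ← integral_adv_visit, ← payoff_sub_payoff]
    ring
  rw [hdiff]
  refine enorm_tsum_le_tsum_enorm.trans_eq (tsum_congr fun t => ?_)
  rw [enorm_mul, enorm_pow, Real.enorm_of_nonneg M.γ_nonneg]

theorem lipschitz_mul_le_penalty (κ : ℝ≥0∞) {α : ℝ} (hα : α ≠ 0) (π₁ π₂ : Policy S A) :
    (2 * M.lipQ π₁ * (⨆ s, LG2 π₁ π₂ s) ^ (1 / 2 : ℝ) + M.lipGradQ π₁ * policyW π₁ π₂) *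
        (ENNReal.ofReal (M.γ / (1 - M.γ)) * κ * policyW π₁ π₂) ≤
      M.C1 κ α π₁ * (⨆ s, LG2 π₁ π₂ s) +
        M.C2 κ α π₁ * ⨆ s : S, wass (π₂.toKernel s) (π₁.toKernel s) ^ 2 := by
  set G := ⨆ s, LG2 π₁ π₂ s
  have hyoung := mul_le_young (G ^ (1 / 2 : ℝ)) (policyW π₁ π₂) hα
  rw [rpow_half_sq] at hyoung
  rw [← policyW_sq]
  calc _ = M.C1' κ π₁ * (G ^ (1 / 2 : ℝ) * policyW π₁ π₂) + M.C2' κ π₁ * policyW π₁ π₂ ^ 2 := by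
        unfold C1' C2'
        ring
    _ ≤ M.C1' κ π₁ * (ENNReal.ofReal (α ^ 2 / 2) * G +
          ENNReal.ofReal (1 / (2 * α ^ 2)) * policyW π₁ π₂ ^ 2) +
        M.C2' κ π₁ * policyW π₁ π₂ ^ 2 := by gcongr
    _ = M.C1 κ α π₁ * G + M.C2 κ α π₁ * policyW π₁ π₂ ^ 2 := by
        unfold C1 C2
        ring

variable {M}

theorem Regular.surrogate_le_payoff [StandardBorelSpace S] {Pol : Set (Policy S A)}
    (hreg : M.Regular Pol) (hS : Convex ℝ S) (hSint : (interior S).Nonempty) (hA : Convex ℝ A)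
    {Lπ Lμ : ℝ≥0} (hLπ : M.LipschitzPolicy Pol Lπ) (hLμ : M.LipschitzState Pol Lμ) {κ : ℝ≥0∞}
    (hκ : M.IsAmplification Pol Lπ Lμ κ) {α : ℝ} (hα : α ≠ 0) {π₁ π₂ : Policy S A}
    (h₁ : π₁ ∈ Pol) (h₂ : π₂ ∈ Pol) : M.surrogate κ α π₁ π₂ ≤ (M.payoff π₂ : EReal) := by
  set K := 2 * M.lipQ π₁ * (⨆ s, LG2 π₁ π₂ s) ^ (1 / 2 : ℝ) + M.lipGradQ π₁ * policyW π₁ π₂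
  have hadv := M.boundedMeasurable_adv π₁ π₂
  have hterm (t : ℕ) : ‖∫ s, M.adv π₁ s π₂ ∂(M.steps M.μ π₁ t) -
      ∫ s, M.adv π₁ s π₂ ∂(M.steps M.μ π₂ t)‖ₑ ≤
        K * wass (M.steps M.μ π₁ t) (M.steps M.μ π₂ t) :=
    enorm_integral_sub_le_wass (hadv.integrable _) (hadv.integrable _)
      (hreg.enorm_adv_sub_le hS hSint hA h₁ h₂)
  refine coe_sub_le_of_enorm_sub_le ((M.enorm_payoff_add_sub_payoff_le π₁ π₂).trans ?_)
  calc _ ≤ ∑' t, ENNReal.ofReal M.γ ^ t * (K * wass (M.steps M.μ π₁ t) (M.steps M.μ π₂ t)) := by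
        gcongr with t
        exact hterm t
    _ = K * ∑' t, ENNReal.ofReal M.γ ^ t * wass (M.steps M.μ π₁ t) (M.steps M.μ π₂ t) := by
        simp only [← ENNReal.tsum_mul_left, mul_left_comm]
    _ ≤ K * (ENNReal.ofReal (M.γ / (1 - M.γ)) * κ * policyW π₁ π₂) := by
        gcongr
        exact tsum_discount_wass_steps_le hLπ hLμ h₁ h₂ M.μ hκ
    _ ≤ _ := M.lipschitz_mul_le_penalty κ hα π₁ π₂

end MDP

end Surrogate

end TDPO

theorem mainTheorem2 {n m : ℕ} (S : Set (TDPO.E n)) (A : Set (TDPO.E m))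
    (hS : MeasurableSet S) (hSconv : Convex ℝ S) (hSint : (interior S).Nonempty)
    (hA : MeasurableSet A) (hAconv : Convex ℝ A) (hAint : (interior A).Nonempty)
    (M : TDPO.MDP S A) (Pol : Set (TDPO.Policy S A)) (hreg : M.Regular Pol)
    (Lπ Lμ : ℝ≥0) (hLπ : M.LipschitzPolicy Pol Lπ) (hLμ : M.LipschitzState Pol Lμ)
    (κ : ℝ≥0∞) (hκ : M.IsAmplification Pol Lπ Lμ κ) :
    (∀ α : ℝ, α ≠ 0 → ∀ π₁ ∈ Pol, ∀ π₂ ∈ Pol,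
      M.surrogate κ α π₁ π₂ ≤ (M.payoff π₂ : EReal)) ∧
    (∀ α : ℝ, α ≠ 0 → ∀ π₁ ∈ Pol, M.surrogate κ α π₁ π₁ = (M.payoff π₁ : EReal)) ∧
    (∀ α : ℕ → ℝ, (∀ k, α k ≠ 0) → ∀ π : ℕ → TDPO.Policy S A, (∀ k, π k ∈ Pol) →
      (∀ k, IsMaxOn (M.surrogate κ (α k) (π k)) Pol (π (k + 1))) →
      Monotone fun k => M.payoff (π k)) := by
  have := hS.standardBorel
  have minorant (α : ℝ) (hα : α ≠ 0) (π₁) (h₁ : π₁ ∈ Pol) (π₂) (h₂ : π₂ ∈ Pol) :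
      M.surrogate κ α π₁ π₂ ≤ (M.payoff π₂ : EReal) :=
    hreg.surrogate_le_payoff hSconv hSint hAconv hLπ hLμ hκ hα h₁ h₂
  refine ⟨minorant, fun α _ π₁ _ => M.surrogate_self κ α π₁, fun α hα π hπ hmax => ?_⟩
  have improves : Monotone fun k => (M.payoff (π k) : EReal) :=
    TDPO.monotone_of_isMaxOn_minorant (f := fun π => (M.payoff π : EReal))
      (L := fun k => M.surrogate κ (α k) (π k)) hπ (fun k => minorant (α k) (hα k) (π k) (hπ k))
      (fun k => (M.surrogate_self κ (α k) (π k)).ge) hmax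
  exact fun i j hij => EReal.coe_le_coe_iff.1 (improves hij)
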